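/- **Definitions.** A graph (in the sense of Serre) has vertices, oriented edges with a fixed-point free involution $e\mapsto\bar e$, and an origin map $\iota$; the star of a vertex $x$ is the set of oriented edges with origin $x$, its cardinality is the valence of $x$, and a morphism of graphs sends vertices to vertices and edges to edges, respecting $\iota$ and the involution. An immersion is a morphism of graphs that is injective on stars. A *graph pair* $(\Gamma,w)$ consists of a finite graph $\Gamma$, not necessarily connected and without vertices of valence one, and an immersion of graphs $w:\mathbb S_w\to\Gamma$, where $\mathbb S_w=\bigsqcup_i S^1_i$ is a finite disjoint union of (subdivided) circles; $w_i$ is the restriction of $w$ to $S^1_i$. A *map of pairs* $(\Gamma',w')\to(\Gamma,w)$ consists of a morphism of graphs $f:\Gamma'\to\Gamma$ and an immersion $\phi:\mathbb S_{w'}\to\mathbb S_w$ with $f\circ w'=w\circ\phi$. It is a *homotopy equivalence* if $f$ is a homotopy equivalence (i.e. induces a bijection on connected components and isomorphisms on the fundamental groups of the components) and $\phi$ is an isomorphism of graphs. The pair $(\Gamma,w)$ is *irreducible* if for every connected component $\Gamma_0$ of $\Gamma$ the following hold: (a) $\pi_1\Gamma_0\neq 1$; (b) $\pi_1\Gamma_0$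 does not split freely relative to $w$, that is, it is not a free product $A*B$ with $A,B\neq1$ such that every $w_i$ contained in $\Gamma_0$ is conjugate into $A$ or into $B$, nor a free product $A*\langle t\rangle$ with $\langle t\rangle$ infinite cyclic and $A$ possibly trivial (an HNN extension over the trivial group) such that every $w_i$ contained in $\Gamma_0$ is conjugate into $A$; (c) it is not the case that exactly one $w_i$ is contained in $\Gamma_0$ and that it generates $\pi_1\Gamma_0$. The *Whitehead graph* $\mathrm{Wh}_x(w)$ at a vertex $x$ of $\Gamma$ is the multigraph whose vertices are the elements of the star of $x$ and whose edges are the vertices $s$ of $\mathbb S_w$ with $w(s)=x$; the edge $s$ joins $w(e_1)$ and $w(e_2)$, where $e_1,e_2$ are the two oriented edges of $\mathbb S_w$ with origin $s$. The pair is *locally irreducible* if, for every vertex $x$ of $\Gamma$, the graph $\mathrm{Wh}_x(w)$ is non-empty and connected, has no leaf (vertex of valence one) and has no cut vertex (vertex whose removal disconnects it). **Statement (converse to Whitehead's lemma).** If a graph pair $(\Gamma,w)$ is irreducible, then there are a locally irreducible graph pair $(\Gamma',w')$ and a map of pairs $(\Gamma',w')\to(\Gamma,w)$ which is a homotopy equivalence.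 -/

import Mathlib

open CategoryTheory

universe u

/-! ### Graphs in the sense of Serre -/

/-- A graph in the sense of Serre: vertices, oriented edges, a fixed-point free involution
reversing the edges, and an origin map. -/
structure SerreGraph where
  V : Type u
  E : Type u
  bar : E → E
  bar_bar : ∀ e, bar (bar e) = e
  bar_ne : ∀ e, bar e ≠ e
  ι : E → V

namespace SerreGraph

/-- The terminus of an oriented edge. -/
def τ (Γ : SerreGraph.{u}) (e : Γ.E) : Γ.V := Γ.ι (Γ.bar e)

/-- The star of a vertex: the oriented edges starting there. -/
def star (Γ : SerreGraph.{u}) (x : Γ.V) : Set Γ.E := {e | Γ.ι e = x}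

/-- A morphism of graphs sends vertices to vertices and edges to edges. -/
structure Hom (Γ Δ : SerreGraph.{u}) where
  onV : Γ.V → Δ.V
  onE : Γ.E → Δ.E
  map_ι : ∀ e, Δ.ι (onE e) = onV (Γ.ι e)
  map_bar : ∀ e, onE (Γ.bar e) = Δ.bar (onE e)

/-- An immersion: a morphism that is injective on every star. -/
def Hom.IsImmersion {Γ Δ : SerreGraph.{u}} (f : Hom Γ Δ) : Prop :=
  ∀ x, Set.InjOn f.onE (Γ.star x)

/-- An isomorphism of graphs. -/
def Hom.IsIso {Γ Δ : SerreGraph.{u}} (f : Hom Γ Δ) : Prop :=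
  Function.Bijective f.onV ∧ Function.Bijective f.onE

theorem Hom.map_τ {Γ Δ : SerreGraph.{u}} (f : Hom Γ Δ) (e : Γ.E) :
    Δ.τ (f.onE e) = f.onV (Γ.τ e) := by
  unfold τ
  rw [← f.map_bar, f.map_ι]

/-! ### The fundamental groupoid and the fundamental group -/

/-- The arrows `x ⟶ y` are the oriented edges from `x` to `y`; `Quiver.Path` is then the type of
edge paths. -/
instance quiver (Γ : SerreGraph.{u}) : Quiver.{u} Γ.V where
  Hom x y := {e : Γ.E // Γ.ι e = x ∧ Γ.τ e = y}

instance involutiveReverse (Γ : SerreGraph.{u}) : Quiver.HasInvolutiveReverse Γ.V where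
  reverse' e := ⟨Γ.bar e.1, e.2.2, by unfold τ; rw [Γ.bar_bar]; exact e.2.1⟩
  inv' e := Subtype.ext (Γ.bar_bar e.1)

/-- The elementary homotopies of edge paths: an edge followed by its reverse is homotopic to the
constant path. -/
inductive Backtrack (Γ : SerreGraph.{u}) : HomRel (Paths Γ.V)
  | mk (x y : Γ.V) (e : x ⟶ y) :
    Backtrack Γ (𝟙 ((Paths.of Γ.V).obj x))
      ((Paths.of Γ.V).map e ≫ (Paths.of Γ.V).map (Quiver.reverse e))

/-- The fundamental groupoid: objects are vertices, morphisms are homotopy classes (relative to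
the endpoints) of edge paths. -/
def FundGpd (Γ : SerreGraph.{u}) : Type u := CategoryTheory.Quotient Γ.Backtrack

namespace FundGpd

instance category (Γ : SerreGraph.{u}) : Category.{u} Γ.FundGpd :=
  CategoryTheory.Quotient.category Γ.Backtrack

/-- Sends an edge path to its homotopy class. -/
def cls (Γ : SerreGraph.{u}) : Paths Γ.V ⥤ Γ.FundGpd :=
  CategoryTheory.Quotient.functor Γ.Backtrack

/-- A vertex, as an object of the fundamental groupoid. -/
abbrev pt (Γ : SerreGraph.{u}) (x : Γ.V) : Γ.FundGpd := (cls Γ).obj ((Paths.of Γ.V).obj x)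

/-- The homotopy class of the path consisting of one edge. -/
abbrev edge (Γ : SerreGraph.{u}) {x y : Γ.V} (e : x ⟶ y) : pt Γ x ⟶ pt Γ y :=
  (cls Γ).map ((Paths.of Γ.V).map e)

theorem edge_reverse (Γ : SerreGraph.{u}) {x y : Γ.V} (e : x ⟶ y) :
    edge Γ e ≫ edge Γ (Quiver.reverse e) = 𝟙 (pt Γ x) := by
  have h := CategoryTheory.Quotient.sound Γ.Backtrack (Backtrack.mk x y e)
  have h' : (cls Γ).map ((Paths.of Γ.V).map e ≫ (Paths.of Γ.V).map (Quiver.reverse e)) =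
      (cls Γ).map (𝟙 _) := h.symm
  rw [CategoryTheory.Functor.map_comp, CategoryTheory.Functor.map_id] at h'
  exact h'

theorem isIso_edge (Γ : SerreGraph.{u}) {x y : Γ.V} (e : x ⟶ y) : IsIso (edge Γ e) :=
  ⟨edge Γ (Quiver.reverse e), edge_reverse Γ e, by
    have h := edge_reverse Γ (Quiver.reverse e)
    rwa [Quiver.reverse_reverse] at h⟩

theorem isIso_cls (Γ : SerreGraph.{u}) {x y : Paths Γ.V} (p : x ⟶ y) :
    IsIso ((cls Γ).map p) := by
  induction p using Paths.induction with
  | id => rw [CategoryTheory.Functor.map_id]; infer_instance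
  | comp p q hp =>
    rw [CategoryTheory.Functor.map_comp]
    have := isIso_edge Γ q
    infer_instance

theorem isIso_hom (Γ : SerreGraph.{u}) {x y : Γ.FundGpd} (g : x ⟶ y) : IsIso g := by
  obtain ⟨p, hp⟩ := (CategoryTheory.Quotient.full_functor Γ.Backtrack).map_surjective
    (X := x.as) (Y := y.as) g
  have h : IsIso ((cls Γ).map p) := isIso_cls Γ p
  have hp' : (cls Γ).map p = g := hp
  rw [hp'] at h
  exact h

noncomputable instance groupoid (Γ : SerreGraph.{u}) : Groupoid.{u} Γ.FundGpd :=
  Groupoid.ofIsIso (isIso_hom Γ)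

end FundGpd

/-- The fundamental group: homotopy classes of closed edge paths at `x`, under concatenation. -/
abbrev π₁ (Γ : SerreGraph.{u}) (x : Γ.V) : Type u := FundGpd.pt Γ x ⟶ FundGpd.pt Γ x

/-- The action of a morphism of graphs on single edges, as a map of quivers. -/
def Hom.toPrefunctor {Γ Δ : SerreGraph.{u}} (f : Hom Γ Δ) : Γ.V ⥤q Δ.V where
  obj := f.onV
  map e := ⟨f.onE e.1, by rw [f.map_ι, e.2.1], by rw [f.map_τ, e.2.2]⟩

/-- The functor of fundamental groupoids induced by a morphism of graphs; on edge paths it applies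
the morphism to each edge. -/
def Hom.mapGpd {Γ Δ : SerreGraph.{u}} (f : Hom Γ Δ) : Γ.FundGpd ⥤ Δ.FundGpd :=
  CategoryTheory.Quotient.lift Γ.Backtrack
    (Paths.lift (f.toPrefunctor ⋙q (Paths.of Δ.V ⋙q (FundGpd.cls Δ).toPrefunctor))) (by
      rintro _ _ _ _ ⟨x, y, e⟩
      rw [CategoryTheory.Functor.map_id, CategoryTheory.Functor.map_comp]
      have h := FundGpd.edge_reverse Δ (f.toPrefunctor.map e)
      have hr : Quiver.reverse (f.toPrefunctor.map e) = f.toPrefunctor.map (Quiver.reverse e) :=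
        Subtype.ext (f.map_bar e.1).symm
      rw [hr] at h
      have key : ∀ {a b : Γ.V} (e : a ⟶ b),
          (Paths.lift (f.toPrefunctor ⋙q (Paths.of Δ.V ⋙q (FundGpd.cls Δ).toPrefunctor))).map
            ((Paths.of Γ.V).map e) = FundGpd.edge Δ (f.toPrefunctor.map e) :=
        fun e => Category.id_comp _
      rw [key, key]
      exact h.symm)

/-- The homomorphism induced on fundamental groups. -/
noncomputable def Hom.mapπ₁ {Γ Δ : SerreGraph.{u}} (f : Hom Γ Δ) (x : Γ.V) :
    Γ.π₁ x →* Δ.π₁ (f.onV x) :=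
  f.mapGpd.mapVertexGroup (FundGpd.pt Γ x)

/-- A morphism of graphs is a homotopy equivalence if it induces an equivalence of fundamental
groupoids, i.e. a bijection on connected components and isomorphisms on the fundamental groups of
all components. (Graphs are aspherical, so this is homotopy equivalence of the realizations.) -/
def Hom.IsHomotopyEquiv {Γ Δ : SerreGraph.{u}} (f : Hom Γ Δ) : Prop :=
  f.mapGpd.IsEquivalence

end SerreGraph

/-! ### Free splittings relative to a family of subgroups -/

section FreeSplittings

variable {G : Type*} [Group G]

/-- `G` is the (internal) free product of its subgroups `A` and `B`. -/
def IsInternalFreeProduct (A B : Subgroup G) : Prop :=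
  Function.Bijective (Monoid.Coprod.lift A.subtype B.subtype)

/-- `H` is conjugate into `A`. -/
def ConjugateInto (H A : Subgroup G) : Prop :=
  ∃ g : G, ∀ h ∈ H, g * h * g⁻¹ ∈ A

/-- `G` splits freely relative to the subgroups `H i`: it is either a free product of two
non-trivial subgroups (an amalgam over the trivial group) or an HNN extension `A * ⟨t⟩` over the
trivial group, in such a way that every `H i` is conjugate into a vertex group. -/
def SplitsFreelyRel {I : Type*} (H : I → Subgroup G) : Prop :=
  (∃ A B : Subgroup G, IsInternalFreeProduct A B ∧ A ≠ ⊥ ∧ B ≠ ⊥ ∧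
    ∀ i, ConjugateInto (H i) A ∨ ConjugateInto (H i) B) ∨
  (∃ (A : Subgroup G) (t : G), IsInternalFreeProduct A (Subgroup.zpowers t) ∧
    (∀ n : ℤ, t ^ n = 1 → n = 0) ∧ ∀ i, ConjugateInto (H i) A)

end FreeSplittings

/-! ### Multigraphs -/

namespace Graph

variable {α β : Type*}

/-- Any two vertices are joined by a path. -/
def IsPathConnected (G : Graph α β) : Prop :=
  ∀ a ∈ G.vertexSet, ∀ b ∈ G.vertexSet, Relation.ReflTransGen G.Adj a b

/-- The valence of a vertex; loops count twice. -/
noncomputable def valence (G : Graph α β) (a : α) : ℕ :=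
  (G.incidenceSet a).ncard + (G.loopSet a).ncard

/-- A leaf is a vertex of valence one. -/
def IsLeaf (G : Graph α β) (a : α) : Prop := a ∈ G.vertexSet ∧ G.valence a = 1

/-- A cut vertex is a vertex whose removal disconnects the graph. -/
def IsCutVertex (G : Graph α β) (a : α) : Prop :=
  a ∈ G.vertexSet ∧ ¬ (G.deleteVerts {a}).IsPathConnected

end Graph

/-! ### Graph pairs -/

/-- A graph pair: a finite graph `Γ`, possibly disconnected, without vertices of valence one,
together with a multicycle, i.e. an immersion `w` from a finite disjoint union of circles `S`
(equivalently, from a finite graph `S` all of whose vertices have valence two). -/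
structure GraphPair where
  Γ : SerreGraph.{u}
  S : SerreGraph.{u}
  finite_ΓV : Finite Γ.V
  finite_ΓE : Finite Γ.E
  finite_SV : Finite S.V
  finite_SE : Finite S.E
  valence_ne_one : ∀ x, (Γ.star x).ncard ≠ 1
  valence_eq_two : ∀ s, (S.star s).ncard = 2
  w : SerreGraph.Hom S Γ
  immersion : w.IsImmersion

namespace GraphPair

open SerreGraph

/-- A morphism of graph pairs `(Γ', w') ⟶ (Γ, w)`: morphisms of graphs `f : Γ' ⟶ Γ` and
`φ : S' ⟶ S` with `f ∘ w' = w ∘ φ`, where `φ` is an immersion. -/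
structure Hom (P' P : GraphPair.{u}) where
  f : SerreGraph.Hom P'.Γ P.Γ
  φ : SerreGraph.Hom P'.S P.S
  immersion : φ.IsImmersion
  comm_V : ∀ s, f.onV (P'.w.onV s) = P.w.onV (φ.onV s)
  comm_E : ∀ e, f.onE (P'.w.onE e) = P.w.onE (φ.onE e)

/-- A morphism of graph pairs is a homotopy equivalence if `Γ' ⟶ Γ` is a homotopy equivalence and
the circles are mapped isomorphically (i.e. the immersion `S' ⟶ S` is a homotopy equivalence). -/
def Hom.IsHomotopyEquiv {P' P : GraphPair.{u}} (m : Hom P' P) : Prop :=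
  m.f.IsHomotopyEquiv ∧ m.φ.IsIso

/-- Given a vertex `s` on a circle `S_i` and a homotopy class of paths from `w s` to `x`, the
image of `π₁(S_i)` in `π₁(Γ, x)`: the cyclic subgroup generated by `w_i`, well defined up to
conjugacy. -/
noncomputable def peripheral (P : GraphPair.{u}) (x : P.Γ.V)
    (i : Σ s : P.S.V, (FundGpd.pt P.Γ (P.w.onV s) ⟶ FundGpd.pt P.Γ x)) :
    Subgroup (P.Γ.π₁ x) :=
  (P.w.mapπ₁ i.1).range.map (Groupoid.vertexGroupIsomOfMap i.2).toMonoidHom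

/-- The component of `x` is cyclic: exactly one circle maps to it, and that circle generates the
fundamental group. -/
def IsCyclicAt (P : GraphPair.{u}) (x : P.Γ.V) : Prop :=
  (∃ i, P.peripheral x i = ⊤) ∧
  ∀ s t : P.S.V,
    Nonempty (FundGpd.pt P.Γ (P.w.onV s) ⟶ FundGpd.pt P.Γ x) →
    Nonempty (FundGpd.pt P.Γ (P.w.onV t) ⟶ FundGpd.pt P.Γ x) →
    Nonempty (FundGpd.pt P.S s ⟶ FundGpd.pt P.S t)

/-- The pair is irreducible if each of its components is. The component of `x` is irreducible if
its relative Grushko decomposition `G₁ * ⋯ * G_k * F` has `k = 1`, `F = 1` and no cyclic factor;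
that is, if its fundamental group is non-trivial, does not split freely relative to `w`, and the
component is not cyclic. -/
def IsIrreducible (P : GraphPair.{u}) : Prop :=
  ∀ x : P.Γ.V,
    Nontrivial (P.Γ.π₁ x) ∧ ¬ SplitsFreelyRel (P.peripheral x) ∧ ¬ P.IsCyclicAt x

/-- The Whitehead graph at `x`: its vertices are the elements of the star of `x`, and its edges
are the vertices `s` of `S` lying over `x`. If `e₁, e₂` are the two edges of `S` starting at `s`,
then `s` joins `w e₁` and `w e₂`. -/
def whitehead (P : GraphPair.{u}) (x : P.Γ.V) : Graph P.Γ.E P.S.V where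
  vertexSet := P.Γ.star x
  IsLink s a b := P.w.onV s = x ∧ ∃ e₁ e₂ : P.S.E, e₁ ≠ e₂ ∧ P.S.ι e₁ = s ∧ P.S.ι e₂ = s ∧
    P.w.onE e₁ = a ∧ P.w.onE e₂ = b
  isLink_symm := by
    rintro s -
    constructor
    rintro a b ⟨hx, e₁, e₂, hne, h₁, h₂, ha, hb⟩
    exact ⟨hx, e₂, e₁, hne.symm, h₂, h₁, hb, ha⟩
  eq_or_eq_of_isLink_of_isLink := by
    rintro s a b c d ⟨-, e₁, e₂, hne, h₁, h₂, rfl, rfl⟩ ⟨-, e₃, e₄, hne', h₃, h₄, rfl, rfl⟩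
    obtain ⟨p, q, -, hpq⟩ := Set.ncard_eq_two.1 (P.valence_eq_two s)
    have key : ∀ e, P.S.ι e = s → e = p ∨ e = q := fun e he => by
      have : e ∈ P.S.star s := he
      rwa [hpq] at this
    rcases key _ h₁ with rfl | rfl <;> rcases key _ h₃ with rfl | rfl <;>
      rcases key _ h₄ with rfl | rfl <;> simp_all
  left_mem_of_isLink := by
    rintro s a b ⟨hx, e₁, e₂, -, h₁, -, rfl, -⟩
    change P.Γ.ι (P.w.onE e₁) = x
    rw [P.w.map_ι, h₁, hx]

/-- The pair is locally irreducible: every Whitehead graph is (non-empty and) connected, has no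
leaf and has no cut vertex. -/
def IsLocallyIrreducible (P : GraphPair.{u}) : Prop :=
  ∀ x : P.Γ.V, (P.Γ.star x).Nonempty ∧ (P.whitehead x).IsPathConnected ∧
    (∀ e, ¬ (P.whitehead x).IsLeaf e) ∧ (∀ e, ¬ (P.whitehead x).IsCutVertex e)

end GraphPair

/-! The argument peels apart cut vertices of Whitehead graphs until none is left, and irreducibility
controls the process at each stage. Connectedness: if the Whitehead graph at `x` is disconnected,
the star of `x` is a union of two disjoint non-empty sets never joined by a turn of `w`. Pulling `x`
apart into two vertices lifts the circles, and regluing exhibits `π₁` as a free product or an HNN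
extension over the trivial group, relative to `w` (`splitsFreelyRel_of_partition`). Cut vertices: if
`a` is a cut vertex of the Whitehead graph at `x`, a component `B` of the rest is moved to a new
vertex, which is joined to the terminus of `a` by a second copy of `a`. Every turn of `w` involving
`B` stays in `B` or goes to `a`, so the circles lift. Folding the two copies of `a` together is a
homotopy equivalence (`isHomotopyEquiv_fold`), hence the new pair is irreducible too. Termination:
connected Whitehead graphs and the absence of vertices of valence one force `w` to run over every
edge (`onE_surjective`). So the number of edges of `Γ` is bounded by that of the circles, which an
unfolding leaves unchanged while `Γ` gains edges. Leaves: when no cut vertex is left, a leaf spreads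
along its component and shows that a single circle maps isomorphically onto it
(`isCyclicAt_of_isLeaf`), which irreducibility excludes. -/

namespace SerreGraph

/-- An oriented edge, as an arrow from its origin to its terminus. -/
def arrow (Γ : SerreGraph.{u}) (e : Γ.E) : Γ.ι e ⟶ Γ.τ e := ⟨e, rfl, rfl⟩

theorem τ_bar (Γ : SerreGraph.{u}) (e : Γ.E) : Γ.τ (Γ.bar e) = Γ.ι e := by
  unfold τ; rw [Γ.bar_bar]

theorem bar_injective (Γ : SerreGraph.{u}) : Function.Injective Γ.bar :=
  Function.LeftInverse.injective Γ.bar_bar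

/-! ### Functors out of the fundamental groupoid -/

namespace FundGpd

variable {Γ : SerreGraph.{u}}

/-- Induction over homotopy classes of edge paths, appending one edge at a time. -/
theorem hom_induction {x : Γ.V} {motive : ∀ y : Γ.V, (pt Γ x ⟶ pt Γ y) → Prop}
    (id : motive x (𝟙 _))
    (comp : ∀ (y z : Γ.V) (g : pt Γ x ⟶ pt Γ y) (e : y ⟶ z), motive y g →
      motive z (g ≫ edge Γ e)) {y : Γ.V} (g : pt Γ x ⟶ pt Γ y) : motive y g := by
  obtain ⟨p, hp⟩ := (CategoryTheory.Quotient.full_functor Γ.Backtrack).map_surjective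
    (X := x) (Y := y) g
  change (cls Γ).map p = g at hp
  subst hp
  refine Paths.induction_fixed_source (a := x)
    (fun {b} (p : @Quiver.Hom (Paths Γ.V) _ x b) =>
      motive b ((cls Γ).map (X := x) (Y := b) p)) ?_ ?_ p
  · exact id
  · intro u v p e h
    exact comp u v ((cls Γ).map (X := x) (Y := u) p) e h

theorem reverse_edge (Γ : SerreGraph.{u}) {x y : Γ.V} (e : x ⟶ y) :
    edge Γ (Quiver.reverse e) ≫ edge Γ e = 𝟙 (pt Γ y) := by
  have h := edge_reverse Γ (Quiver.reverse e)
  rwa [Quiver.reverse_reverse] at h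

section Lift

variable {C : Type*} [Category C] (obj : Γ.V → C)
  (map : ∀ {x y : Γ.V}, (x ⟶ y) → (obj x ⟶ obj y))
  (h : ∀ {x y : Γ.V} (e : x ⟶ y), map e ≫ map (Quiver.reverse e) = 𝟙 _)

/-- The functor out of the fundamental groupoid determined by its values on edges. -/
def lift : Γ.FundGpd ⥤ C :=
  CategoryTheory.Quotient.lift Γ.Backtrack (Paths.lift ⟨obj, map⟩) (by
    rintro _ _ _ _ ⟨x, y, e⟩
    rw [CategoryTheory.Functor.map_id, CategoryTheory.Functor.map_comp]
    have key : ∀ {a b : Γ.V} (e : a ⟶ b),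
        (Paths.lift (⟨obj, map⟩ : Γ.V ⥤q C)).map ((Paths.of Γ.V).map e) = map e :=
      fun e => Category.id_comp _
    rw [key, key]
    exact (h e).symm)

theorem lift_edge {x y : Γ.V} (e : x ⟶ y) : (lift obj map h).map (edge Γ e) = map e :=
  Category.id_comp _

end Lift

/-- Two functors out of the fundamental groupoid are isomorphic if they are so on edges. -/
noncomputable def natIso {C : Type*} [Category C] {F G : Γ.FundGpd ⥤ C}
    (c : ∀ x : Γ.V, F.obj (pt Γ x) ≅ G.obj (pt Γ x))
    (h : ∀ {x y : Γ.V} (e : x ⟶ y),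
      F.map (edge Γ e) ≫ (c y).hom = (c x).hom ≫ G.map (edge Γ e)) : F ≅ G :=
  NatIso.ofComponents (fun X => c X.as) (by
    intro X Y f
    exact hom_induction (Γ := Γ) (x := X.as)
      (motive := fun y f => F.map f ≫ (c y).hom = (c X.as).hom ≫ G.map f)
      (by simp) (by
        intro y z g e hg
        rw [Functor.map_comp, Functor.map_comp, Category.assoc, h, reassoc_of% hg]) f)

end FundGpd

open FundGpd

theorem Hom.mapGpd_edge {Γ Δ : SerreGraph.{u}} (f : Hom Γ Δ) {x y : Γ.V} (e : x ⟶ y) :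
    f.mapGpd.map (edge Γ e) = edge Δ (f.toPrefunctor.map e) :=
  Category.id_comp _

/-- Composition of morphisms of graphs. -/
def Hom.comp {Γ Δ Θ : SerreGraph.{u}} (f : Hom Γ Δ) (g : Hom Δ Θ) : Hom Γ Θ where
  onV := g.onV ∘ f.onV
  onE := g.onE ∘ f.onE
  map_ι e := by simp [g.map_ι, f.map_ι]
  map_bar e := by simp [g.map_bar, f.map_bar]

/-- The identity morphism. -/
def Hom.id (Γ : SerreGraph.{u}) : Hom Γ Γ where
  onV := _root_.id
  onE := _root_.id
  map_ι _ := rfl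
  map_bar _ := rfl

theorem Hom.ext {Γ Δ : SerreGraph.{u}} {f g : Hom Γ Δ} (hV : f.onV = g.onV)
    (hE : f.onE = g.onE) : f = g := by
  cases f; cases g; cases hV; cases hE; rfl

/-- The induced functors on fundamental groupoids are compatible with composition. -/
noncomputable def Hom.mapGpdComp {Γ Δ Θ : SerreGraph.{u}} (f : Hom Γ Δ) (g : Hom Δ Θ) :
    (f.comp g).mapGpd ≅ f.mapGpd ⋙ g.mapGpd :=
  natIso (fun x => Iso.refl (pt Θ (g.onV (f.onV x)))) (by
    intro x y e
    refine (Category.comp_id _).trans (Eq.trans ?_ (Category.id_comp _).symm)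
    refine ((f.comp g).mapGpd_edge e).trans (Eq.symm ?_)
    exact (congrArg g.mapGpd.map (f.mapGpd_edge e)).trans (g.mapGpd_edge _))

/-- The action of a morphism of graphs on homotopy classes of paths. -/
def Hom.mapHom {Γ Δ : SerreGraph.{u}} (f : Hom Γ Δ) {x y : Γ.V} (p : pt Γ x ⟶ pt Γ y) :
    pt Δ (f.onV x) ⟶ pt Δ (f.onV y) := f.mapGpd.map p

/-- The action of a morphism of graphs on arrows. -/
def Hom.mapArrow {Γ Δ : SerreGraph.{u}} (f : Hom Γ Δ) {x y : Γ.V} (e : x ⟶ y) :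
    f.onV x ⟶ f.onV y := f.toPrefunctor.map e

section MapHom

variable {Γ Δ Θ : SerreGraph.{u}} (f : Hom Γ Δ)

theorem Hom.mapHom_edge {x y : Γ.V} (e : x ⟶ y) :
    f.mapHom (edge Γ e) = edge Δ (f.mapArrow e) := f.mapGpd_edge e

theorem Hom.mapHom_id (x : Γ.V) : f.mapHom (𝟙 (pt Γ x)) = 𝟙 _ := f.mapGpd.map_id _

theorem Hom.mapHom_comp {x y z : Γ.V} (p : pt Γ x ⟶ pt Γ y) (q : pt Γ y ⟶ pt Γ z) :
    f.mapHom (p ≫ q) = f.mapHom p ≫ f.mapHom q := f.mapGpd.map_comp _ _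

theorem Hom.mapHom_inv {x y : Γ.V} (p : pt Γ x ⟶ pt Γ y) :
    f.mapHom (inv p) = inv (f.mapHom p) := by
  refine IsIso.eq_inv_of_hom_inv_id ?_
  rw [← mapHom_comp, IsIso.hom_inv_id, mapHom_id]

theorem Hom.comp_mapHom (g : Hom Δ Θ) {x y : Γ.V} (p : pt Γ x ⟶ pt Γ y) :
    (f.comp g).mapHom p = g.mapHom (f.mapHom p) := by
  have h := (Hom.mapGpdComp f g).hom.naturality p
  exact (Category.comp_id _).symm.trans (h.trans (Category.id_comp _))

/-- The action of a morphism of graphs on homotopy classes of paths, with prescribed images of the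
endpoints. -/
def Hom.mapTo {u v : Γ.V} {x y : Δ.V} (hu : f.onV u = x) (hv : f.onV v = y)
    (p : pt Γ u ⟶ pt Γ v) : pt Δ x ⟶ pt Δ y :=
  eqToHom (congrArg (pt Δ) hu.symm) ≫ f.mapHom p ≫ eqToHom (congrArg (pt Δ) hv)

variable {u v t : Γ.V} {x y z : Δ.V} (hu : f.onV u = x) (hv : f.onV v = y) (ht : f.onV t = z)

theorem Hom.mapTo_rfl (p : pt Γ u ⟶ pt Γ v) : f.mapTo rfl rfl p = f.mapHom p := by
  rw [mapTo, eqToHom_refl, eqToHom_refl, Category.id_comp, Category.comp_id]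

theorem Hom.mapTo_comp (p : pt Γ u ⟶ pt Γ v) (q : pt Γ v ⟶ pt Γ t) :
    f.mapTo hu ht (p ≫ q) = f.mapTo hu hv p ≫ f.mapTo hv ht q := by
  subst hu hv ht
  rw [mapTo_rfl, mapTo_rfl, mapTo_rfl, mapHom_comp]

theorem Hom.mapTo_id : f.mapTo hu hu (𝟙 _) = 𝟙 _ := by
  subst hu
  rw [mapTo_rfl, mapHom_id]

theorem Hom.mapTo_inv (p : pt Γ u ⟶ pt Γ v) : f.mapTo hv hu (inv p) = inv (f.mapTo hu hv p) := by
  subst hu hv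
  rw [mapTo_rfl, mapTo_rfl, mapHom_inv]

theorem Hom.mapTo_edge (e : u ⟶ v) : f.mapTo hu hv (edge Γ e) =
    edge Δ ⟨f.onE e.1, by rw [f.map_ι, e.2.1, hu], by rw [f.map_τ, e.2.2, hv]⟩ := by
  subst hu hv
  rw [mapTo_rfl, mapHom_edge]
  rfl

end MapHom

theorem Hom.IsHomotopyEquiv.comp {Γ Δ Θ : SerreGraph.{u}} {f : Hom Γ Δ} {g : Hom Δ Θ}
    (hf : f.IsHomotopyEquiv) (hg : g.IsHomotopyEquiv) : (f.comp g).IsHomotopyEquiv := by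
  have := hf; have := hg
  unfold Hom.IsHomotopyEquiv at *
  exact Functor.isEquivalence_of_iso (Hom.mapGpdComp f g).symm

/-- The identity morphism induces the identity functor. -/
noncomputable def Hom.mapGpdId (Γ : SerreGraph.{u}) : (Hom.id Γ).mapGpd ≅ 𝟭 Γ.FundGpd :=
  natIso (fun x => Iso.refl (pt Γ x)) (by
    intro x y e
    refine (Category.comp_id _).trans (Eq.trans ?_ (Category.id_comp _).symm)
    exact (Hom.id Γ).mapGpd_edge e)

theorem Hom.isHomotopyEquiv_id (Γ : SerreGraph.{u}) : (Hom.id Γ).IsHomotopyEquiv :=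
  Functor.isEquivalence_of_iso (Hom.mapGpdId Γ).symm

/-! ### Labellings of the edges by a group -/

/-- The one-object groupoid of a group, with composition in the order of multiplication. -/
def Deloop (_ : Type*) : Type := Unit

instance Deloop.category (H : Type*) [Group H] : Category (Deloop H) where
  Hom _ _ := H
  id _ := 1
  comp a b := a * b
  id_comp := one_mul
  comp_id := mul_one
  assoc := mul_assoc

section Label

variable {Γ : SerreGraph.{u}} {H : Type*} [Group H] (l : Γ.E → H)
  (hl : ∀ e, l (Γ.bar e) = (l e)⁻¹)

/-- The functor to the group given by a labelling. -/
def labelFunctor : Γ.FundGpd ⥤ Deloop H :=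
  lift (C := Deloop H) (fun _ => ()) (fun e => l e.1)
    (fun e => by
      change l e.1 * l (Γ.bar e.1) = 1
      rw [hl, mul_inv_cancel])

/-- The product of the labels along a homotopy class of paths. -/
def label {x y : Γ.V} (p : pt Γ x ⟶ pt Γ y) : H := (labelFunctor l hl).map p

theorem label_id (x : Γ.V) : label l hl (𝟙 (pt Γ x)) = 1 :=
  (labelFunctor l hl).map_id _

theorem label_comp {x y z : Γ.V} (p : pt Γ x ⟶ pt Γ y) (q : pt Γ y ⟶ pt Γ z) :
    label l hl (p ≫ q) = label l hl p * label l hl q :=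
  (labelFunctor l hl).map_comp _ _

theorem label_edge {x y : Γ.V} (e : x ⟶ y) : label l hl (edge Γ e) = l e.1 :=
  lift_edge (C := Deloop H) (fun _ => ()) (fun e => l e.1)
    (fun e => by
      change l e.1 * l (Γ.bar e.1) = 1
      rw [hl, mul_inv_cancel]) e

end Label

end SerreGraph

/-- This and the next two cancellations serve to check that folding and unfolding are mutually
inverse. -/
theorem CategoryTheory.inv_eq_conj {C : Type*} [Category C] {a b x y : C} {p : a ⟶ x}
    {q : b ⟶ y} {e : a ⟶ b} {g : x ⟶ y} (hp : IsIso p) (hq : IsIso q) (he : IsIso e)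
    (hg : IsIso g) (h : g = inv p ≫ e ≫ q) : inv g = inv q ≫ inv e ≫ p := by
  subst h; simp

theorem CategoryTheory.conj_comp_inv {C : Type*} [Category C] {a b x y : C} {p : a ⟶ x}
    {q : b ⟶ y} {e : a ⟶ b} (hp : IsIso p) (hq : IsIso q) :
    (inv p ≫ e ≫ q) ≫ inv q = inv p ≫ e := by
  simp

theorem CategoryTheory.inv_id_comp {C : Type*} [Category C] {a b c y : C} {e : a ⟶ b}
    {f : c ⟶ b} {q : b ⟶ y} (he : IsIso e) (hf : IsIso f) :
    inv (𝟙 c) ≫ f ≫ q = inv (e ≫ inv f) ≫ e ≫ q := by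
  simp

/-! ### Unfolding at a vertex as a homotopy equivalence -/

namespace SerreGraph

open FundGpd

namespace FundGpd

variable {Γ : SerreGraph.{u}}

theorem inv_edge {x y : Γ.V} (e : x ⟶ y) : inv (edge Γ e) = edge Γ (Quiver.reverse e) :=
  IsIso.inv_eq_of_hom_inv_id (edge_reverse Γ e)

theorem edge_eqToHom {e : Γ.E} {u v u' v' : Γ.V} (hu : u = u') (hv : v = v')
    (h : Γ.ι e = u ∧ Γ.τ e = v) (h' : Γ.ι e = u' ∧ Γ.τ e = v') :
    edge Γ (⟨e, h⟩ : u ⟶ v) ≫ eqToHom (congrArg (pt Γ) hv) =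
      eqToHom (congrArg (pt Γ) hu) ≫ edge Γ (⟨e, h'⟩ : u' ⟶ v') := by
  subst hu hv
  rw [eqToHom_refl, eqToHom_refl, Category.comp_id, Category.id_comp]

end FundGpd

open Classical in
/-- The origin map after splitting off a new vertex `none` as the origin of the edges in `B`. -/
noncomputable def splitι (Γ : SerreGraph.{u}) (B : Set Γ.E) (e : Γ.E) : Option Γ.V :=
  if e ∈ B then none else some (Γ.ι e)

theorem splitι_of_mem {Γ : SerreGraph.{u}} {B : Set Γ.E} {e : Γ.E} (h : e ∈ B) :
    Γ.splitι B e = none := if_pos h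

theorem splitι_of_notMem {Γ : SerreGraph.{u}} {B : Set Γ.E} {e : Γ.E} (h : e ∉ B) :
    Γ.splitι B e = some (Γ.ι e) := if_neg h

theorem splitι_getD {Γ : SerreGraph.{u}} {B : Set Γ.E} {x : Γ.V} (hB : B ⊆ Γ.star x) (e : Γ.E) :
    (Γ.splitι B e).getD x = Γ.ι e := by
  by_cases h : e ∈ B
  · rw [splitι_of_mem h]; exact (hB h).symm
  · rw [splitι_of_notMem h]; rfl

/-- Split off a new vertex `none` as the origin of the edges in `B`, and join it to the terminus
of `a` by a copy of `a`. -/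
noncomputable def unfold (Γ : SerreGraph.{u}) (B : Set Γ.E) (a : Γ.E) : SerreGraph.{u} where
  V := Option Γ.V
  E := Γ.E ⊕ Bool
  bar := Sum.map Γ.bar not
  bar_bar e := by cases e <;> simp [Γ.bar_bar]
  bar_ne e := by cases e <;> simp [Γ.bar_ne]
  ι := Sum.elim (Γ.splitι B) (fun b => if b then none else Γ.splitι B (Γ.bar a))

section Unfold

variable {Γ : SerreGraph.{u}} {B : Set Γ.E} {a : Γ.E}

/-- Fold the copy of `a` back onto `a`. -/
noncomputable def fold (hB : B ⊆ Γ.star (Γ.ι a)) : Hom (Γ.unfold B a) Γ where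
  onV v := v.getD (Γ.ι a)
  onE := Sum.elim id (fun b => if b then a else Γ.bar a)
  map_ι e := by
    rcases e with e | _ | _
    · exact (splitι_getD hB e).symm
    · exact (splitι_getD hB (Γ.bar a)).symm
    · rfl
  map_bar e := by
    rcases e with e | _ | _
    · rfl
    · exact (Γ.bar_bar a).symm
    · rfl

/-- The new vertex of the unfolded graph. -/
def unfoldNew : (Γ.unfold B a).V := none

/-- The old vertices of the unfolded graph. -/
def unfoldOld (v : Γ.V) : (Γ.unfold B a).V := some v

/-- The origin of an old edge in the unfolded graph. -/
noncomputable def unfoldι (e : Γ.E) : (Γ.unfold B a).V := Γ.splitι B e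

/-- The new copy of `a`. -/
noncomputable def unfoldArrow : (unfoldNew : (Γ.unfold B a).V) ⟶ unfoldι (Γ.bar a) :=
  ⟨.inr true, rfl, rfl⟩

/-- The old copy of `a`. -/
noncomputable def unfoldArrow' (ha : a ∉ B) :
    (unfoldOld (Γ.ι a) : (Γ.unfold B a).V) ⟶ unfoldι (Γ.bar a) :=
  ⟨.inl a, splitι_of_notMem ha, rfl⟩

/-- The path from the new vertex to the old one along the two copies of `a`. -/
noncomputable def unfoldPath (ha : a ∉ B) :
    pt (Γ.unfold B a) unfoldNew ⟶ pt (Γ.unfold B a) (unfoldOld (Γ.ι a)) :=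
  edge (Γ.unfold B a) unfoldArrow ≫ edge (Γ.unfold B a) (Quiver.reverse (unfoldArrow' ha))

/-- A path from each vertex to the old vertex in the same fibre of the folding map. -/
noncomputable def fibrePath (hB : B ⊆ Γ.star (Γ.ι a)) (ha : a ∉ B) :
    ∀ (u : (Γ.unfold B a).V) (v : Γ.V), (fold hB).onV u = v →
      (pt (Γ.unfold B a) u ⟶ pt (Γ.unfold B a) (unfoldOld v))
  | none, _, rfl => unfoldPath ha
  | some _, _, rfl => 𝟙 _

theorem fold_unfoldι (hB : B ⊆ Γ.star (Γ.ι a)) {v v' : Γ.V} (e : v ⟶ v') :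
    (fold hB).onV (unfoldι e.1) = v := (splitι_getD hB e.1).trans e.2.1

theorem fold_unfoldι_bar (hB : B ⊆ Γ.star (Γ.ι a)) {v v' : Γ.V} (e : v ⟶ v') :
    (fold hB).onV (unfoldι (Γ.bar e.1)) = v' := (splitι_getD hB (Γ.bar e.1)).trans e.2.2

/-- The image of an edge under the inverse of the folding map. -/
noncomputable def unfoldEdge (hB : B ⊆ Γ.star (Γ.ι a)) (ha : a ∉ B) {v v' : Γ.V} (e : v ⟶ v') :
    pt (Γ.unfold B a) (unfoldOld v) ⟶ pt (Γ.unfold B a) (unfoldOld v') :=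
  -- In the unfolded graph the edge may start or end at the new vertex; the fibre paths move its
  -- endpoints back to the old vertices.
  inv (fibrePath hB ha (unfoldι e.1) v (fold_unfoldι hB e)) ≫
    edge (Γ.unfold B a) (⟨.inl e.1, rfl, rfl⟩ :
      (unfoldι e.1 : (Γ.unfold B a).V) ⟶ unfoldι (Γ.bar e.1)) ≫
    fibrePath hB ha (unfoldι (Γ.bar e.1)) v' (fold_unfoldι_bar hB e)

/-- Endpoints are only required to be equal to the origin and terminus, not identical by definition:
for a reversed edge they agree only through `bar_bar`. -/
theorem unfoldEdge_eq (hB : B ⊆ Γ.star (Γ.ι a)) (ha : a ∉ B) {v v' : Γ.V} (e : v ⟶ v')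
    {u u' : (Γ.unfold B a).V} (hu : (fold hB).onV u = v) (hu' : (fold hB).onV u' = v')
    (h : (Γ.unfold B a).ι (.inl e.1) = u ∧ (Γ.unfold B a).τ (.inl e.1) = u') :
    unfoldEdge hB ha e = inv (fibrePath hB ha u v hu) ≫
      edge (Γ.unfold B a) (⟨.inl e.1, h⟩ : u ⟶ u') ≫ fibrePath hB ha u' v' hu' := by
  obtain ⟨rfl, rfl⟩ := h
  rfl

theorem unfoldEdge_reverse (hB : B ⊆ Γ.star (Γ.ι a)) (ha : a ∉ B) {v v' : Γ.V} (e : v ⟶ v') :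
    unfoldEdge hB ha e ≫ unfoldEdge hB ha (Quiver.reverse e) = 𝟙 _ := by
  rw [unfoldEdge_eq hB ha e (fold_unfoldι hB e) (fold_unfoldι_bar hB e) ⟨rfl, rfl⟩,
    unfoldEdge_eq hB ha (Quiver.reverse e) (fold_unfoldι_bar hB e) (fold_unfoldι hB e)
      ⟨rfl, by exact congrArg (Γ.splitι B) (Γ.bar_bar e.1)⟩]
  have := edge_reverse (Γ.unfold B a) (⟨.inl e.1, rfl, rfl⟩ :
      (unfoldι e.1 : (Γ.unfold B a).V) ⟶ unfoldι (Γ.bar e.1))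
  simp only [Category.assoc, IsIso.hom_inv_id_assoc]
  rw [IsIso.inv_comp_eq, Category.comp_id]
  exact (reassoc_of% this) _

/-- The inverse of the folding map, on fundamental groupoids. -/
noncomputable def unfoldFunctor (hB : B ⊆ Γ.star (Γ.ι a)) (ha : a ∉ B) :
    Γ.FundGpd ⥤ (Γ.unfold B a).FundGpd :=
  lift (fun v => pt (Γ.unfold B a) (unfoldOld v)) (fun e => unfoldEdge hB ha e)
    (unfoldEdge_reverse hB ha)

theorem unfoldFunctor_edge (hB : B ⊆ Γ.star (Γ.ι a)) (ha : a ∉ B) {v v' : Γ.V} (e : v ⟶ v') :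
    (unfoldFunctor hB ha).map (edge Γ e) = unfoldEdge hB ha e := lift_edge _ _ _ e

/-- The one non-constant fibre path runs along one copy of `a` and back along the other, so its
image is a backtrack. -/
theorem fold_map_fibrePath (hB : B ⊆ Γ.star (Γ.ι a)) (ha : a ∉ B) (u : (Γ.unfold B a).V)
    (v : Γ.V) (h : (fold hB).onV u = v) :
    (fold hB).mapGpd.map (fibrePath hB ha u v h) = eqToHom (congrArg (pt Γ) h) := by
  subst h
  rcases u with _ | u
  · change (fold hB).mapGpd.map (unfoldPath ha) = 𝟙 _
    have h₁ := (fold hB).mapGpd_edge (unfoldArrow (B := B) (a := a))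
    have h₂ := (fold hB).mapGpd_edge (Quiver.reverse (unfoldArrow' (B := B) (a := a) ha))
    refine ((fold hB).mapGpd.map_comp _ _).trans ?_
    rw [h₁, h₂]
    exact edge_reverse Γ ((fold hB).toPrefunctor.map (unfoldArrow (B := B) (a := a)))
  · exact (fold hB).mapGpd.map_id _

theorem fold_map_unfoldEdge (hB : B ⊆ Γ.star (Γ.ι a)) (ha : a ∉ B) {v v' : Γ.V} (e : v ⟶ v') :
    (fold hB).mapGpd.map (unfoldEdge hB ha e) = edge Γ e := by
  unfold unfoldEdge
  rw [Functor.map_comp, Functor.map_comp, Functor.map_inv]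
  refine (IsIso.inv_comp_eq _).2 ?_
  refine (congrArg (_ ≫ ·) (fold_map_fibrePath hB ha _ _ _)).trans (Eq.trans ?_
    (congrArg (· ≫ _) (fold_map_fibrePath hB ha _ _ _)).symm)
  refine (congrArg (· ≫ _) ((fold hB).mapGpd_edge _)).trans ?_
  exact edge_eqToHom (fold_unfoldι hB e) (fold_unfoldι_bar hB e) _ e.2

/-- For old edges this is the definition of `unfoldEdge`. For the new copy of `a` it holds because
the fibre path at the new vertex is itself made of the two copies of `a`; the reversed copy follows
by inverting. -/
theorem unfoldFunctor_map_fold (hB : B ⊆ Γ.star (Γ.ι a)) (ha : a ∉ B)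
    {u u' : (Γ.unfold B a).V} (e : u ⟶ u') :
    (unfoldFunctor hB ha).map ((fold hB).mapGpd.map (edge (Γ.unfold B a) e)) =
      inv (fibrePath hB ha u _ rfl) ≫ edge (Γ.unfold B a) e ≫ fibrePath hB ha u' _ rfl := by
  have hrev : ∀ {u u' : (Γ.unfold B a).V} (e : u ⟶ u'),
    (unfoldFunctor hB ha).map ((fold hB).mapGpd.map (edge (Γ.unfold B a) e)) =
      inv (fibrePath hB ha u _ rfl) ≫ edge (Γ.unfold B a) e ≫ fibrePath hB ha u' _ rfl →
    (unfoldFunctor hB ha).map ((fold hB).mapGpd.map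
      (edge (Γ.unfold B a) (Quiver.reverse e))) =
      inv (fibrePath hB ha u' _ rfl) ≫ edge (Γ.unfold B a) (Quiver.reverse e) ≫
        fibrePath hB ha u _ rfl := by
    intro u u' e h
    rw [← inv_edge, Functor.map_inv, Functor.map_inv]
    exact inv_eq_conj (isIso_hom _ _) (isIso_hom _ _) (isIso_hom _ _) (isIso_hom _ _) h
  have htrue : (unfoldFunctor hB ha).map ((fold hB).mapGpd.map
      (edge (Γ.unfold B a) (unfoldArrow (B := B) (a := a)))) =
      inv (fibrePath hB ha unfoldNew _ rfl) ≫ edge (Γ.unfold B a) unfoldArrow ≫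
        fibrePath hB ha (unfoldι (Γ.bar a)) _ rfl := by
    refine (congrArg (unfoldFunctor hB ha).map ((fold hB).mapGpd_edge _)).trans ?_
    refine (unfoldFunctor_edge hB ha _).trans ?_
    refine (unfoldEdge_eq hB ha
      ((fold hB).toPrefunctor.map unfoldArrow) (u := unfoldOld (Γ.ι a)) (u' := unfoldι (Γ.bar a)) rfl rfl
      ⟨splitι_of_notMem ha, rfl⟩).trans ?_
    change inv (𝟙 _) ≫ edge (Γ.unfold B a) (unfoldArrow' ha) ≫ _ =
      inv (unfoldPath ha) ≫ _ ≫ _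
    unfold unfoldPath
    rw [← inv_edge]
    exact inv_id_comp (isIso_hom _ _) (isIso_hom _ _)
  obtain ⟨e | _ | _, he⟩ := e
  · refine (congrArg (unfoldFunctor hB ha).map ((fold hB).mapGpd_edge _)).trans ?_
    exact (unfoldFunctor_edge hB ha _).trans (unfoldEdge_eq hB ha
      ((fold hB).toPrefunctor.map (⟨.inl e, he⟩ : u ⟶ u')) rfl rfl he)
  · obtain ⟨rfl, rfl⟩ := he
    exact hrev _ htrue
  · obtain ⟨rfl, rfl⟩ := he
    exact htrue

/-- The two copies of `a` share their terminus and have distinct origins, so folding them merges two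
vertices without creating or killing loops. The fibre paths are the natural isomorphism from the
composite on the unfolded graph to the identity; the other composite fixes every edge class. -/
theorem isHomotopyEquiv_fold (hB : B ⊆ Γ.star (Γ.ι a)) (ha : a ∉ B) :
    (fold hB).IsHomotopyEquiv := by
  let η : 𝟭 Γ.FundGpd ≅ unfoldFunctor hB ha ⋙ (fold hB).mapGpd :=
    natIso (fun v => Iso.refl (pt Γ v)) (by
      intro v v' e
      refine (Category.comp_id _).trans (Eq.trans ?_ (Category.id_comp _).symm)
      exact ((congrArg (fold hB).mapGpd.map (unfoldFunctor_edge hB ha e)).trans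
        (fold_map_unfoldEdge hB ha e)).symm)
  let ε : (fold hB).mapGpd ⋙ unfoldFunctor hB ha ≅ 𝟭 (Γ.unfold B a).FundGpd :=
    natIso (fun u => (asIso (fibrePath hB ha u ((fold hB).onV u) rfl)).symm) (by
      intro u u' e
      refine (congrArg (· ≫ _) (unfoldFunctor_map_fold hB ha e)).trans ?_
      exact conj_comp_inv (isIso_hom _ _) (isIso_hom _ _))
  exact Functor.IsEquivalence.mk' _ ε.symm η.symm

end Unfold

end SerreGraph

/-! ### Invariance under homotopy equivalences -/

theorem SplitsFreelyRel.map {G G' : Type*} [Group G] [Group G'] {I I' : Type*}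
    {H : I → Subgroup G} {H' : I' → Subgroup G'} (h : SplitsFreelyRel H) (φ : G ≃* G')
    (hH : ∀ i', ∃ i, ∀ g ∈ H' i', φ.symm g ∈ H i) : SplitsFreelyRel H' := by
  have hconj : ∀ (A : Subgroup G) (i : I) (i' : I'), (∀ g ∈ H' i', φ.symm g ∈ H i) →
      ConjugateInto (H i) A → ConjugateInto (H' i') (A.map φ.toMonoidHom) := by
    rintro A i i' hi ⟨g, hg⟩
    refine ⟨φ g, fun k hk => ⟨_, hg _ (hi k hk), ?_⟩⟩
    simp
  have hprod : ∀ A B : Subgroup G, IsInternalFreeProduct A B →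
      IsInternalFreeProduct (A.map φ.toMonoidHom) (B.map φ.toMonoidHom) := by
    intro A B hAB
    let e := MulEquiv.coprodCongr (φ.subgroupMap A) (φ.subgroupMap B)
    have he : (Monoid.Coprod.lift (A.map φ.toMonoidHom).subtype
        (B.map φ.toMonoidHom).subtype).comp e.toMonoidHom =
        φ.toMonoidHom.comp (Monoid.Coprod.lift A.subtype B.subtype) := by
      ext <;> rfl
    have hb : Function.Bijective ((Monoid.Coprod.lift (A.map φ.toMonoidHom).subtype
        (B.map φ.toMonoidHom).subtype) ∘ e) := by
      have := congrArg (fun f : _ →* _ => (f : _ → _)) he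
      refine (congrArg Function.Bijective this).mpr ?_
      exact φ.bijective.comp hAB
    exact (Function.Bijective.of_comp_iff _ e.bijective).1 hb
  have hbot : ∀ A : Subgroup G, A ≠ ⊥ → A.map φ.toMonoidHom ≠ ⊥ := by
    intro A hA h
    exact hA ((Subgroup.map_eq_bot_iff_of_injective A φ.injective).1 h)
  rcases h with ⟨A, B, hAB, hA, hB, hi⟩ | ⟨A, t, hAt, ht, hi⟩
  · refine .inl ⟨_, _, hprod A B hAB, hbot A hA, hbot B hB, fun i' => ?_⟩
    obtain ⟨i, h⟩ := hH i'
    exact (hi i).imp (hconj A i i' h) (hconj B i i' h)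
  · refine .inr ⟨A.map φ.toMonoidHom, φ t, ?_, ?_, fun i' => ?_⟩
    · have := hprod _ _ hAt
      rwa [MonoidHom.map_zpowers] at this
    · intro n hn
      rw [← map_zpow] at hn
      exact ht n ((map_eq_one_iff φ φ.injective).1 hn)
    · obtain ⟨i, h⟩ := hH i'
      exact hconj A i i' h (hi i)

namespace SerreGraph

theorem Hom.IsIso.isHomotopyEquiv {Γ Δ : SerreGraph.{u}} {f : Hom Γ Δ} (hf : f.IsIso) :
    f.IsHomotopyEquiv := by
  let eV := Equiv.ofBijective f.onV hf.1
  let eE := Equiv.ofBijective f.onE hf.2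
  have hE : ∀ e, f.onE (eE.symm e) = e := eE.apply_symm_apply
  let g : Hom Δ Γ :=
    { onV := eV.symm
      onE := eE.symm
      map_ι := fun e => by
        apply hf.1.1
        rw [← f.map_ι, hE]
        exact (eV.apply_symm_apply _).symm
      map_bar := fun e => by
        apply hf.2.1
        rw [f.map_bar, hE, hE] }
  have h₁ : f.comp g = Hom.id Γ :=
    Hom.ext (funext eV.symm_apply_apply) (funext eE.symm_apply_apply)
  have h₂ : g.comp f = Hom.id Δ :=
    Hom.ext (funext eV.apply_symm_apply) (funext eE.apply_symm_apply)
  exact Functor.IsEquivalence.mk' g.mapGpd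
    ((Hom.mapGpdId Γ).symm ≪≫ (eqToIso (congrArg Hom.mapGpd h₁)).symm ≪≫ Hom.mapGpdComp f g)
    ((Hom.mapGpdComp g f).symm ≪≫ eqToIso (congrArg Hom.mapGpd h₂) ≪≫ Hom.mapGpdId Δ)

end SerreGraph

open SerreGraph FundGpd

namespace GraphPair

theorem mem_peripheral (P : GraphPair.{u}) {x : P.Γ.V}
    {i : Σ s : P.S.V, (FundGpd.pt P.Γ (P.w.onV s) ⟶ FundGpd.pt P.Γ x)} {g : P.Γ.π₁ x} :
    g ∈ P.peripheral x i ↔ ∃ p : P.S.π₁ i.1, inv i.2 ≫ P.w.mapHom p ≫ i.2 = g := by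
  constructor
  · rintro ⟨_, ⟨p, rfl⟩, rfl⟩
    refine ⟨p, ?_⟩
    exact congrArg (· ≫ _) (Groupoid.inv_eq_inv i.2).symm
  · rintro ⟨p, rfl⟩
    refine ⟨_, ⟨p, rfl⟩, ?_⟩
    exact congrArg (· ≫ _) (Groupoid.inv_eq_inv i.2)

namespace Hom

variable {P' P : GraphPair.{u}} (m : Hom P' P)

theorem w_comp_f : P'.w.comp m.f = m.φ.comp P.w :=
  SerreGraph.Hom.ext (funext m.comm_V) (funext m.comm_E)

/-- The comparison of the two images of a vertex of a circle. -/
noncomputable def square (s : P'.S.V) :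
    pt P.Γ (m.f.onV (P'.w.onV s)) ⟶ pt P.Γ (P.w.onV (m.φ.onV s)) :=
  eqToHom (congrArg (pt P.Γ) (m.comm_V s))

theorem square_naturality {s t : P'.S.V} (p : pt P'.S s ⟶ pt P'.S t) :
    m.f.mapHom (P'.w.mapHom p) ≫ m.square t =
      m.square s ≫ P.w.mapHom (m.φ.mapHom p) := by
  rw [← SerreGraph.Hom.comp_mapHom, ← SerreGraph.Hom.comp_mapHom]
  have h : ∀ (g : SerreGraph.Hom P'.S P.Γ) (hg : P'.w.comp m.f = g),
      (P'.w.comp m.f).mapHom p ≫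
        eqToHom (congrArg (fun g : SerreGraph.Hom P'.S P.Γ => pt P.Γ (g.onV t)) hg) =
      eqToHom (congrArg (fun g : SerreGraph.Hom P'.S P.Γ => pt P.Γ (g.onV s)) hg) ≫
        g.mapHom p := by
    rintro g rfl
    exact (Category.comp_id _).trans (Category.id_comp _).symm
  exact h _ m.w_comp_f

theorem conj_square {x' : P'.Γ.V} {s : P'.S.V}
    (γ' : pt P'.Γ (P'.w.onV s) ⟶ pt P'.Γ x')
    (γ : pt P.Γ (P.w.onV (m.φ.onV s)) ⟶ pt P.Γ (m.f.onV x'))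
    (h : m.square s ≫ γ = m.f.mapHom γ') (p : P'.S.π₁ s) :
    inv γ ≫ P.w.mapHom (m.φ.mapHom p) ≫ γ =
      m.f.mapHom (inv γ' ≫ P'.w.mapHom p ≫ γ') := by
  refine (IsIso.inv_comp_eq _).2 ?_
  refine (cancel_epi (m.square s)).1 ?_
  rw [← Category.assoc, ← square_naturality, Category.assoc, h, ← Category.assoc, h,
    ← SerreGraph.Hom.mapHom_comp, ← SerreGraph.Hom.mapHom_comp, IsIso.hom_inv_id_assoc]

variable {m} in
-- An equivalence of groupoids is full and faithful, and `φ` is an isomorphism, so vertex groups and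
-- peripheral subgroups of the two pairs correspond. Thus a splitting or a cyclic component upstairs
-- gives one downstairs.
theorem IsHomotopyEquiv.isIrreducible (hm : m.IsHomotopyEquiv) (hP : P.IsIrreducible) :
    P'.IsIrreducible := by
  obtain ⟨hf, hφ⟩ := hm
  have hφ' : m.φ.mapGpd.IsEquivalence := hφ.isHomotopyEquiv
  have hf' : m.f.mapGpd.IsEquivalence := hf
  intro x'
  obtain ⟨h₁, h₂, h₃⟩ := hP (m.f.onV x')
  have hsurj : ∀ {a b : P'.Γ.V} (g : pt P.Γ (m.f.onV a) ⟶ pt P.Γ (m.f.onV b)),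
      ∃ g' : pt P'.Γ a ⟶ pt P'.Γ b, m.f.mapHom g' = g :=
    fun g => m.f.mapGpd.map_surjective g
  have hinj : ∀ {a b : P'.Γ.V} {g g' : pt P'.Γ a ⟶ pt P'.Γ b},
      m.f.mapHom g = m.f.mapHom g' → g = g' :=
    fun h => m.f.mapGpd.map_injective h
  have hS : ∀ {s t : P'.S.V} (g : pt P.S (m.φ.onV s) ⟶ pt P.S (m.φ.onV t)),
      ∃ g' : pt P'.S s ⟶ pt P'.S t, m.φ.mapHom g' = g :=
    fun g => m.φ.mapGpd.map_surjective g
  have hlift : ∀ (s : P'.S.V) (γ : pt P.Γ (P.w.onV (m.φ.onV s)) ⟶ pt P.Γ (m.f.onV x')),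
      ∃ γ' : pt P'.Γ (P'.w.onV s) ⟶ pt P'.Γ x', m.square s ≫ γ = m.f.mapHom γ' := by
    intro s γ
    obtain ⟨γ', h⟩ := hsurj (m.square s ≫ γ)
    exact ⟨γ', h.symm⟩
  refine ⟨?_, fun h => h₂ ?_, fun h => h₃ ⟨?_, ?_⟩⟩
  · exact Function.Surjective.nontrivial
      (f := (m.f.mapHom : P'.Γ.π₁ x' → P.Γ.π₁ (m.f.onV x'))) fun g => hsurj g
  · let ψ : P'.Γ.π₁ x' ≃* P.Γ.π₁ (m.f.onV x') :=
      MulEquiv.ofBijective (m.f.mapπ₁ x') ⟨fun _ _ h => hinj h, fun g => hsurj g⟩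
    refine h.map ψ ?_
    rintro ⟨s, γ⟩
    obtain ⟨s, rfl⟩ := hφ.1.2 s
    obtain ⟨γ', hγ⟩ := hlift s γ
    refine ⟨⟨s, γ'⟩, fun g hg => ?_⟩
    obtain ⟨q, rfl⟩ := P.mem_peripheral.1 hg
    obtain ⟨p, rfl⟩ := hS q
    refine P'.mem_peripheral.2 ⟨p, ?_⟩
    refine (ψ.symm_apply_eq.2 ?_).symm
    exact m.conj_square γ' γ hγ p
  · obtain ⟨⟨s, γ'⟩, hi⟩ := h.1
    refine ⟨⟨m.φ.onV s, inv (m.square s) ≫ m.f.mapHom γ'⟩, ?_⟩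
    rw [eq_top_iff]
    intro g _
    obtain ⟨g', rfl⟩ := hsurj g
    have hg : g' ∈ P'.peripheral x' ⟨s, γ'⟩ := hi ▸ Subgroup.mem_top g'
    obtain ⟨p, rfl⟩ := P'.mem_peripheral.1 hg
    exact P.mem_peripheral.2 ⟨m.φ.mapHom p,
      m.conj_square γ' _ (IsIso.hom_inv_id_assoc _ _) p⟩
  · rintro s t ⟨γ⟩ ⟨δ⟩
    obtain ⟨s, rfl⟩ := hφ.1.2 s
    obtain ⟨t, rfl⟩ := hφ.1.2 t
    obtain ⟨γ', -⟩ := hlift s γ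
    obtain ⟨δ', -⟩ := hlift t δ
    obtain ⟨p⟩ := h.2 s t ⟨γ'⟩ ⟨δ'⟩
    exact ⟨m.φ.mapHom p⟩

end Hom

end GraphPair

/-- A criterion for internal free products: the inclusions into the abstract free product extend
to the group. -/
theorem IsInternalFreeProduct.of_hom {G : Type*} [Group G] {A B : Subgroup G}
    (θ : G →* Monoid.Coprod A B) (hA : ∀ a : A, θ a = Monoid.Coprod.inl a)
    (hB : ∀ b : B, θ b = Monoid.Coprod.inr b) (htop : A ⊔ B = ⊤) :
    IsInternalFreeProduct A B := by
  constructor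
  · have h : θ.comp (Monoid.Coprod.lift A.subtype B.subtype) = MonoidHom.id _ := by
      ext a
      · simpa using hA a
      · simpa using hB a
    exact Function.LeftInverse.injective (g := θ) fun z => DFunLike.congr_fun h z
  · rw [← MonoidHom.range_eq_top, Monoid.Coprod.range_lift, Subgroup.range_subtype,
      Subgroup.range_subtype, htop]

/-! ### Homomorphisms on fundamental groups defined by edge labels -/

namespace SerreGraph

open FundGpd

section Label

variable {Γ Δ : SerreGraph.{u}} {H : Type*} [Group H]

/-- A labelling, as a homomorphism on the fundamental group. -/
def labelHom (l : Γ.E → H) (hl : ∀ e, l (Γ.bar e) = (l e)⁻¹) (x : Γ.V) : Γ.π₁ x →* H where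
  toFun := label l hl
  map_one' := label_id l hl x
  map_mul' := label_comp l hl

/-- A function on homotopy classes of paths is multiplicative. -/
def IsMultiplicative (R : ∀ {u v : Γ.V}, (pt Γ u ⟶ pt Γ v) → H) : Prop :=
  ∀ (u v w : Γ.V) (p : pt Γ u ⟶ pt Γ v) (q : pt Γ v ⟶ pt Γ w), R (p ≫ q) = R p * R q

/-- The labelling of the edges induced by a function on paths. -/
def edgeLabel {H : Type*} (R : ∀ {u v : Γ.V}, (pt Γ u ⟶ pt Γ v) → H) (e : Γ.E) : H :=
  R (edge Γ (Γ.arrow e))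

theorem edgeLabel_eq {H : Type*} (R : ∀ {u v : Γ.V}, (pt Γ u ⟶ pt Γ v) → H) {u v : Γ.V}
    (e : u ⟶ v) : edgeLabel R e.1 = R (edge Γ e) := by
  obtain ⟨e, rfl, rfl⟩ := e
  rfl

variable {R : ∀ {u v : Γ.V}, (pt Γ u ⟶ pt Γ v) → H}

theorem IsMultiplicative.map_id (hR : IsMultiplicative R) (u : Γ.V) : R (𝟙 (pt Γ u)) = 1 := by
  have h := hR _ _ _ (𝟙 (pt Γ u)) (𝟙 (pt Γ u))
  rw [Category.comp_id] at h
  exact (left_eq_mul.1 h)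

theorem IsMultiplicative.edgeLabel_bar (hR : IsMultiplicative R) (e : Γ.E) :
    edgeLabel R (Γ.bar e) = (edgeLabel R e)⁻¹ := by
  rw [eq_inv_iff_mul_eq_one]
  have h := edgeLabel_eq R (Quiver.reverse (Γ.arrow e))
  change edgeLabel R (Γ.bar e) = _ at h
  rw [h]
  unfold edgeLabel
  rw [← hR, reverse_edge]
  exact hR.map_id _

/-- A multiplicative function on paths descends along a morphism which is bijective on edges. -/
theorem IsMultiplicative.label_mapTo (hR : IsMultiplicative R) (f : Hom Γ Δ) (l : Δ.E → H)
    (hl : ∀ e, l (Δ.bar e) = (l e)⁻¹) (h : ∀ e, l (f.onE e) = edgeLabel R e) {u v : Γ.V}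
    {x y : Δ.V} (hu : f.onV u = x) (hv : f.onV v = y) (p : pt Γ u ⟶ pt Γ v) :
    label l hl (f.mapTo hu hv p) = R p := by
  revert y
  refine hom_induction (motive := fun v p => ∀ {y : Δ.V} (hv : f.onV v = y),
    label l hl (f.mapTo hu hv p) = R p) ?_ ?_ p
  · intro y hv
    subst hu hv
    rw [Hom.mapTo_id, label_id]
    exact (hR.map_id _).symm
  · intro v t g e hg y ht
    rw [Hom.mapTo_comp f hu rfl ht, label_comp, hg, Hom.mapTo_edge, label_edge]
    exact (congrArg _ ((h e.1).trans (edgeLabel_eq R e))).trans (hR _ _ _ _ _).symm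

/-- The homomorphism on the fundamental group induced by a multiplicative function on paths along
a morphism which is bijective on edges. -/
theorem IsMultiplicative.exists_hom (hR : IsMultiplicative R) (f : Hom Γ Δ)
    (hf : Function.Bijective f.onE) (x : Δ.V) : ∃ θ : Δ.π₁ x →* H, ∀ {u v : Γ.V}
      (hu : f.onV u = x) (hv : f.onV v = x) (p : pt Γ u ⟶ pt Γ v),
      θ (f.mapTo hu hv p) = R p := by
  let eE := Equiv.ofBijective f.onE hf
  have hl : ∀ e, edgeLabel R (eE.symm (Δ.bar e)) = (edgeLabel R (eE.symm e))⁻¹ := by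
    intro e
    rw [← hR.edgeLabel_bar]
    congr 1
    rw [Equiv.symm_apply_eq]
    exact ((f.map_bar _).trans (congrArg _ (eE.apply_symm_apply e))).symm
  exact ⟨labelHom (fun e => edgeLabel R (eE.symm e)) hl x, fun hu hv p => hR.label_mapTo f
    (fun e => edgeLabel R (eE.symm e)) hl
    (fun e => congrArg (edgeLabel R) (eE.symm_apply_apply e)) hu hv p⟩

end Label

/-! ### Retractions onto a vertex group -/

section Retraction

variable {Γ : SerreGraph.{u}} (a : Γ.V)

/-- A chosen path to the base point, constant at the base point. -/
noncomputable def toBase {u : Γ.V} (h : Nonempty (pt Γ u ⟶ pt Γ a)) : pt Γ u ⟶ pt Γ a :=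
  h.some ≫ inv (⟨𝟙 _⟩ : Nonempty (pt Γ a ⟶ pt Γ a)).some

theorem toBase_self (h : Nonempty (pt Γ a ⟶ pt Γ a)) : toBase a h = 𝟙 _ :=
  IsIso.hom_inv_id _

open Classical in
/-- The retraction of the fundamental groupoid onto a vertex group, trivial outside of the
component of the base point. -/
noncomputable def retraction {u v : Γ.V} (p : pt Γ u ⟶ pt Γ v) : Γ.π₁ a :=
  if h : Nonempty (pt Γ v ⟶ pt Γ a) then
    inv (toBase a (h.map (p ≫ ·))) ≫ p ≫ toBase a h else 1

theorem retraction_of_isEmpty {u v : Γ.V} (p : pt Γ u ⟶ pt Γ v)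
    (h : ¬ Nonempty (pt Γ v ⟶ pt Γ a)) : retraction a p = 1 := dif_neg h

theorem isMultiplicative_retraction :
    IsMultiplicative (fun {u v} (p : pt Γ u ⟶ pt Γ v) => retraction a p) := by
  intro u v w p q
  change retraction a (p ≫ q) = retraction a p * retraction a q
  by_cases hw : Nonempty (pt Γ w ⟶ pt Γ a)
  · have hv : Nonempty (pt Γ v ⟶ pt Γ a) := hw.map (q ≫ ·)
    unfold retraction
    rw [dif_pos hw, dif_pos hv, dif_pos hw, Groupoid.vertexGroup_mul]
    simp
  · have hv : ¬ Nonempty (pt Γ v ⟶ pt Γ a) := fun h => hw (h.map (inv q ≫ ·))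
    rw [retraction_of_isEmpty a _ hw, retraction_of_isEmpty a _ hw,
      retraction_of_isEmpty a _ hv, one_mul]

/-- The factors `k v` cancel at intermediate vertices. With `k` concentrated at one vertex, the
twist detects passages between two vertices that are about to be identified. -/
theorem isMultiplicative_twist {H : Type*} [Group H] (k : Γ.V → H) (i : Γ.π₁ a →* H) :
    IsMultiplicative fun {u v} (p : pt Γ u ⟶ pt Γ v) =>
      (k u)⁻¹ * i (retraction a p) * k v := by
  intro u v w p q
  have ha := isMultiplicative_retraction a _ _ _ p q
  beta_reduce at ha ⊢
  rw [ha, map_mul]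
  group

theorem retraction_self (p : Γ.π₁ a) : retraction a p = p := by
  unfold retraction
  rw [dif_pos ⟨𝟙 _⟩]
  simp only [toBase_self, IsIso.inv_id, Category.comp_id, Category.id_comp]

/-- Provides the path whose image becomes the stable letter of the HNN extension. -/
theorem exists_retraction_eq_one {u : Γ.V} (h : Nonempty (pt Γ u ⟶ pt Γ a)) :
    ∃ p : pt Γ a ⟶ pt Γ u, retraction a p = 1 := by
  refine ⟨inv (toBase a h), ?_⟩
  unfold retraction
  rw [dif_pos h]
  simp [toBase_self]

end Retraction

/-! ### Identifying two vertices -/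

/-- A morphism of graphs which identifies two vertices `a` and `b` to a vertex `x` and is bijective
otherwise. -/
structure Hom.Identifies {Δ Γ : SerreGraph.{u}} (f : Hom Δ Γ) (a b : Δ.V) (x : Γ.V) : Prop where
  map_left : f.onV a = x
  map_right : f.onV b = x
  bijective_onE : Function.Bijective f.onE
  eq_or : ∀ {u v : Δ.V}, f.onV u = f.onV v → u = v ∨ (u = a ∧ v = b) ∨ (u = b ∧ v = a)

namespace Hom.Identifies

variable {Δ Γ : SerreGraph.{u}} {f : Hom Δ Γ} {a b : Δ.V} {x : Γ.V}

/-- The image of the fundamental group at the first vertex. -/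
def left (hf : f.Identifies a b x) : Δ.π₁ a →* Γ.π₁ x where
  toFun := f.mapTo hf.map_left hf.map_left
  map_one' := f.mapTo_id _
  map_mul' := f.mapTo_comp _ _ _

/-- The image of the fundamental group at the second vertex. -/
def right (hf : f.Identifies a b x) : Δ.π₁ b →* Γ.π₁ x where
  toFun := f.mapTo hf.map_right hf.map_right
  map_one' := f.mapTo_id _
  map_mul' := f.mapTo_comp _ _ _

theorem symm (hf : f.Identifies a b x) : f.Identifies b a x :=
  ⟨hf.map_right, hf.map_left, hf.bijective_onE, fun h => (hf.eq_or h).imp_right Or.symm⟩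

/-- The retraction onto the vertex group at `a` depends only on edge labels, so it descends along
`f` to a left inverse. -/
theorem left_injective (hf : f.Identifies a b x) : Function.Injective hf.left := by
  obtain ⟨θ, hθ⟩ := (isMultiplicative_retraction a).exists_hom f hf.bijective_onE x
  intro p q h
  rw [← retraction_self a p, ← retraction_self a q, ← hθ hf.map_left hf.map_left,
    ← hθ hf.map_left hf.map_left]
  exact congrArg θ h

/-- Every path from `x` lifts, after multiplication by an element of a subgroup containing all
paths between the two vertices. -/
theorem factor (hf : f.Identifies a b x) (M : Subgroup (Γ.π₁ x)) (hl : ∀ p, hf.left p ∈ M)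
    (hr : ∀ p, hf.right p ∈ M)
    (hab : ∀ p : pt Δ a ⟶ pt Δ b, f.mapTo hf.map_left hf.map_right p ∈ M)
    {y : Γ.V} (γ : pt Γ x ⟶ pt Γ y) {v : Δ.V} (hv : f.onV v = y) :
    (∃ m ∈ M, ∃ q, γ = m ≫ f.mapTo hf.map_left hv q) ∨
    (∃ m ∈ M, ∃ q, γ = m ≫ f.mapTo hf.map_right hv q) := by
  have hba : ∀ p : pt Δ b ⟶ pt Δ a, f.mapTo hf.map_right hf.map_left p ∈ M := by
    intro p
    rw [← inv_mem_iff]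
    have h := hab (inv p)
    rwa [Hom.mapTo_inv f hf.map_right, ← Groupoid.inv_eq_inv] at h
  revert v
  refine hom_induction (motive := fun y γ => ∀ {v} (hv : f.onV v = y),
    (∃ m ∈ M, ∃ q, γ = m ≫ f.mapTo hf.map_left hv q) ∨
    (∃ m ∈ M, ∃ q, γ = m ≫ f.mapTo hf.map_right hv q)) ?_ ?_ γ
  · intro v hv
    have h : v = a ∨ v = b := by
      rcases hf.eq_or (hv.trans hf.map_left.symm) with h | h | h
      exacts [.inl h, .inl h.1, .inr h.1]
    rcases h with rfl | rfl
    · refine .inl ⟨𝟙 _, M.one_mem, 𝟙 _, ?_⟩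
      rw [Hom.mapTo_id, Category.id_comp]
    · refine .inr ⟨𝟙 _, M.one_mem, 𝟙 _, ?_⟩
      rw [Hom.mapTo_id, Category.id_comp]
  · rintro y z g ⟨e, he⟩ ih v hv
    obtain ⟨e, rfl⟩ := hf.bijective_onE.2 e
    have hι : f.onV (Δ.ι e) = y := (f.map_ι e).symm.trans he.1
    have hτ : f.onV (Δ.τ e) = z := (f.map_τ e).symm.trans he.2
    have step : (∃ m ∈ M, ∃ q, g ≫ edge Γ ⟨f.onE e, he⟩ = m ≫ f.mapTo hf.map_left hτ q) ∨
        (∃ m ∈ M, ∃ q, g ≫ edge Γ ⟨f.onE e, he⟩ = m ≫ f.mapTo hf.map_right hτ q) := by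
      have he' := f.mapTo_edge hι hτ (Δ.arrow e)
      refine (ih hι).imp ?_ ?_
      · rintro ⟨m, hm, q, rfl⟩
        refine ⟨m, hm, q ≫ edge Δ (Δ.arrow e), ?_⟩
        rw [Hom.mapTo_comp f _ hι, he', Category.assoc]
        rfl
      · rintro ⟨m, hm, q, rfl⟩
        refine ⟨m, hm, q ≫ edge Δ (Δ.arrow e), ?_⟩
        rw [Hom.mapTo_comp f _ hι, he', Category.assoc]
        rfl
    generalize g ≫ edge Γ ⟨f.onE e, he⟩ = γ at step
    generalize Δ.τ e = u at hτ step
    -- The edge just appended may end at the twin of the prescribed endpoint. Then the lifted path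
    -- so far joins vertices among `a` and `b`; its image lies in `M` and is absorbed into `m`, and
    -- lifting restarts with the constant path at the twin.
    rcases hf.eq_or (hτ.trans hv.symm) with rfl | ⟨rfl, rfl⟩ | ⟨rfl, rfl⟩
    · exact step
    · obtain rfl : x = z := hf.map_left.symm.trans hτ
      refine .inr ?_
      rcases step with ⟨m, hm, q, rfl⟩ | ⟨m, hm, q, rfl⟩
      · refine ⟨_, M.mul_mem hm (hl q), 𝟙 _, ?_⟩
        rw [Hom.mapTo_id, Category.comp_id]
        rfl
      · refine ⟨_, M.mul_mem hm (hba q), 𝟙 _, ?_⟩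
        rw [Hom.mapTo_id, Category.comp_id]
        rfl
    · obtain rfl : x = z := hf.map_right.symm.trans hτ
      refine .inl ?_
      rcases step with ⟨m, hm, q, rfl⟩ | ⟨m, hm, q, rfl⟩
      · refine ⟨_, M.mul_mem hm (hab q), 𝟙 _, ?_⟩
        rw [Hom.mapTo_id, Category.comp_id]
        rfl
      · refine ⟨_, M.mul_mem hm (hr q), 𝟙 _, ?_⟩
        rw [Hom.mapTo_id, Category.comp_id]
        rfl

theorem eq_top (hf : f.Identifies a b x) (M : Subgroup (Γ.π₁ x)) (hl : ∀ p, hf.left p ∈ M)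
    (hr : ∀ p, hf.right p ∈ M)
    (hab : ∀ p : pt Δ a ⟶ pt Δ b, f.mapTo hf.map_left hf.map_right p ∈ M) : M = ⊤ := by
  rw [eq_top_iff]
  intro γ _
  rcases hf.factor M hl hr hab γ hf.map_left with ⟨m, hm, q, rfl⟩ | ⟨m, hm, q, rfl⟩
  · exact M.mul_mem hm (hl q)
  · refine M.mul_mem hm (M.inv_mem_iff.1 ?_)
    have h := hab (inv q)
    rwa [Hom.mapTo_inv f hf.map_right, ← Groupoid.inv_eq_inv] at h

theorem nonempty_hom (hf : f.Identifies a b x) {y : Γ.V} (γ : pt Γ x ⟶ pt Γ y) {v : Δ.V}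
    (hv : f.onV v = y) : Nonempty (pt Δ a ⟶ pt Δ v) ∨ Nonempty (pt Δ b ⟶ pt Δ v) :=
  (hf.factor ⊤ (fun _ => trivial) (fun _ => trivial) (fun _ => trivial) γ hv).imp
    (fun ⟨_, _, q, _⟩ => ⟨q⟩) (fun ⟨_, _, q, _⟩ => ⟨q⟩)

/-- If the two vertices lie in different components, the fundamental group is a free product. -/
theorem isInternalFreeProduct (hf : f.Identifies a b x) (h : ¬ Nonempty (pt Δ a ⟶ pt Δ b)) :
    IsInternalFreeProduct hf.left.range hf.right.range := by
  let i : Δ.π₁ a →* Monoid.Coprod hf.left.range hf.right.range :=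
    Monoid.Coprod.inl.comp hf.left.rangeRestrict
  let j : Δ.π₁ b →* Monoid.Coprod hf.left.range hf.right.range :=
    Monoid.Coprod.inr.comp hf.right.rangeRestrict
  -- A path lies in the component of at most one of `a` and `b`, so at most one of the two
  -- retractions is non-trivial and the factors never have to be interchanged.
  have hR : IsMultiplicative fun {u v} (p : pt Δ u ⟶ pt Δ v) =>
      i (retraction a p) * j (retraction b p) := by
    intro u v w p q
    have ha := isMultiplicative_retraction a _ _ _ p q
    have hb := isMultiplicative_retraction b _ _ _ p q
    beta_reduce at ha hb ⊢
    rw [ha, hb, map_mul, map_mul]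
    by_cases hw : Nonempty (pt Δ w ⟶ pt Δ a)
    · have hv : ¬ Nonempty (pt Δ v ⟶ pt Δ b) := fun ⟨s⟩ =>
        h ⟨inv hw.some ≫ inv q ≫ s⟩
      rw [retraction_of_isEmpty b p hv, map_one, one_mul, mul_one, mul_assoc]
    · rw [retraction_of_isEmpty a q hw, map_one, one_mul, mul_one, mul_assoc]
  obtain ⟨θ, hθ⟩ := hR.exists_hom f hf.bijective_onE x
  refine .of_hom θ ?_ ?_ ?_
  · rintro ⟨_, p, rfl⟩
    refine (hθ hf.map_left hf.map_left p).trans ?_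
    rw [retraction_self, retraction_of_isEmpty b p h, map_one, mul_one]
    rfl
  · rintro ⟨_, p, rfl⟩
    refine (hθ hf.map_right hf.map_right p).trans ?_
    rw [retraction_self, retraction_of_isEmpty a p fun ⟨s⟩ => h ⟨inv s⟩, map_one, one_mul]
    rfl
  · exact hf.eq_top _ (fun p => (le_sup_left : _ ≤ hf.left.range ⊔ _) ⟨p, rfl⟩)
      (fun p => (le_sup_right : _ ≤ _ ⊔ hf.right.range) ⟨p, rfl⟩) (fun p => (h ⟨p⟩).elim)

open Classical in
/-- If the two vertices lie in one component, the fundamental group is an HNN extension over the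
trivial group. -/
theorem exists_isInternalFreeProduct_zpowers (hf : f.Identifies a b x) (hab : a ≠ b)
    (h : Nonempty (pt Δ a ⟶ pt Δ b)) :
    ∃ t : Γ.π₁ x, IsInternalFreeProduct hf.left.range (Subgroup.zpowers t) ∧
      ∀ n : ℤ, t ^ n = 1 → n = 0 := by
  obtain ⟨s, hs⟩ := exists_retraction_eq_one a (h.map (fun p => inv p))
  set t : Γ.π₁ x := f.mapTo hf.map_left hf.map_right s with ht
  refine ⟨t, ?_, ?_⟩
  · let i : Δ.π₁ a →* Monoid.Coprod hf.left.range (Subgroup.zpowers t) :=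
      Monoid.Coprod.inl.comp hf.left.rangeRestrict
    -- The twist is `t` at `b` and trivial elsewhere: loops at `a` keep their value, while the path
    -- `s` from `a` to `b`, with trivial retraction, takes the value `t`.
    let k : Δ.V → Monoid.Coprod hf.left.range (Subgroup.zpowers t) := fun v =>
      if v = b then Monoid.Coprod.inr ⟨t, Subgroup.mem_zpowers t⟩ else 1
    obtain ⟨θ, hθ⟩ := (isMultiplicative_twist a k i).exists_hom f hf.bijective_onE x
    have hka : k a = 1 := if_neg hab
    have hkb : k b = Monoid.Coprod.inr ⟨t, Subgroup.mem_zpowers t⟩ := if_pos rfl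
    have hθt : θ t = Monoid.Coprod.inr ⟨t, Subgroup.mem_zpowers t⟩ := by
      refine (hθ hf.map_left hf.map_right s).trans ?_
      rw [hka, hkb, hs, map_one, inv_one, one_mul, one_mul]
    refine .of_hom θ ?_ ?_ ?_
    · rintro ⟨_, p, rfl⟩
      refine (hθ hf.map_left hf.map_left p).trans ?_
      rw [retraction_self, hka, inv_one, one_mul, mul_one]
      rfl
    · rintro ⟨_, n, rfl⟩
      change θ (t ^ n) = _
      rw [map_zpow, hθt, ← map_zpow]
      rfl
    · have hl : ∀ p, hf.left p ∈ hf.left.range ⊔ Subgroup.zpowers t := fun p =>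
        (le_sup_left : _ ≤ hf.left.range ⊔ _) ⟨p, rfl⟩
      have htM : t ∈ hf.left.range ⊔ Subgroup.zpowers t :=
        (le_sup_right : _ ≤ _ ⊔ Subgroup.zpowers t) (Subgroup.mem_zpowers t)
      refine hf.eq_top _ hl ?_ ?_
      · intro p
        have hp : hf.right p = t⁻¹ * hf.left (s ≫ p ≫ inv s) * t := by
          change _ = (t⁻¹ * f.mapTo hf.map_left hf.map_left _) * t
          rw [Hom.mapTo_comp f _ hf.map_right, Hom.mapTo_comp f _ hf.map_right,
            Hom.mapTo_inv f hf.map_left, ← ht, ← Groupoid.inv_eq_inv]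
          change _ = (t⁻¹ * (t * (f.mapTo hf.map_right hf.map_right p * t⁻¹))) * t
          rw [inv_mul_cancel_left, inv_mul_cancel_right]
          rfl
        rw [hp]
        exact mul_mem (mul_mem (inv_mem htM) (hl _)) htM
      · intro p
        have hp : f.mapTo hf.map_left hf.map_right p = hf.left (p ≫ inv s) * t := by
          change _ = f.mapTo hf.map_left hf.map_left _ ≫ t
          rw [ht, ← Hom.mapTo_comp]
          simp
        rw [hp]
        exact mul_mem (hl _) htM
  -- The same twist with integer values and the trivial map on loops sends `t` to a generator of
  -- `ℤ`.
  · obtain ⟨θ, hθ⟩ := (isMultiplicative_twist a (H := Multiplicative ℤ)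
      (fun v => if v = b then Multiplicative.ofAdd 1 else 1) 1).exists_hom
        f hf.bijective_onE x
    have hθt : θ t = Multiplicative.ofAdd 1 := by
      refine (hθ hf.map_left hf.map_right s).trans ?_
      rw [if_neg hab, if_pos rfl]
      rfl
    intro n hn
    have := congrArg θ hn
    rw [map_zpow, hθt, θ.map_one, ← ofAdd_zsmul] at this
    simpa using this

end Hom.Identifies

end SerreGraph

namespace SerreGraph

open FundGpd

/-! ### Finite graphs with non-trivial fundamental group -/

section Nontrivial

variable {Γ : SerreGraph.{u}}

/-- There is an edge path of the given length from `x` to the given vertex. -/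
inductive Reach (x : Γ.V) : ℕ → Γ.V → Prop
  | nil : Reach x 0 x
  | cons (n : ℕ) (e : Γ.E) : Reach x n (Γ.ι e) → Reach x (n + 1) (Γ.τ e)

theorem exists_reach {x y : Γ.V} (p : pt Γ x ⟶ pt Γ y) : ∃ n, Reach x n y := by
  refine hom_induction (motive := fun y _ => ∃ n, Reach x n y) ⟨0, .nil⟩ ?_ p
  rintro _ _ _ ⟨e, rfl, rfl⟩ ⟨n, h⟩
  exact ⟨n + 1, .cons n e h⟩

open Classical in
/-- The signed indicator of an edge. -/
noncomputable def edgeIndicator (a e : Γ.E) : Multiplicative ℤ :=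
  Multiplicative.ofAdd ((if e = a then 1 else 0) - (if e = Γ.bar a then 1 else 0))

open Classical in
theorem edgeIndicator_bar (a e : Γ.E) : edgeIndicator a (Γ.bar e) = (edgeIndicator a e)⁻¹ := by
  have h : Γ.bar e = a ↔ e = Γ.bar a :=
    ⟨fun h => by rw [← h, Γ.bar_bar], fun h => by rw [h, Γ.bar_bar]⟩
  unfold edgeIndicator
  rw [← ofAdd_neg, neg_sub, if_congr h rfl rfl, if_congr Γ.bar_injective.eq_iff rfl rfl]

theorem edgeIndicator_self (a : Γ.E) : edgeIndicator a a ≠ 1 := by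
  unfold edgeIndicator
  rw [if_pos rfl, if_neg (Γ.bar_ne a).symm]
  decide

theorem edgeIndicator_of_ne {a e : Γ.E} (h₁ : e ≠ a) (h₂ : e ≠ Γ.bar a) :
    edgeIndicator a e = 1 := by
  unfold edgeIndicator
  rw [if_neg h₁, if_neg h₂]
  rfl

/-- A connected finite graph with at least one edge, all of whose vertices except possibly `x` have
valence different from one, is not simply connected. -/
theorem nontrivial_π₁ [Finite Γ.V] {x : Γ.V} (hx : (Γ.star x).Nonempty)
    (hval : ∀ v, v ≠ x → Nonempty (pt Γ x ⟶ pt Γ v) → (Γ.star v).ncard ≠ 1) :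
    Nontrivial (Γ.π₁ x) := by
  by_contra hnt
  rw [not_nontrivial_iff_subsingleton] at hnt
  have hsub : ∀ {v : Γ.V} (p q : pt Γ x ⟶ pt Γ v), p = q := by
    intro v p q
    have h : p ≫ inv q = 𝟙 _ := Subsingleton.elim (α := Γ.π₁ x) _ _
    rwa [IsIso.comp_inv_eq, Category.id_comp] at h
  -- A loop edge would be a closed path with signed count one over itself.
  have hloop : ∀ e : Γ.E, Nonempty (pt Γ x ⟶ pt Γ (Γ.ι e)) → Γ.τ e ≠ Γ.ι e := by
    rintro e ⟨p⟩ he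
    have h := hsub (p ≫ edge Γ (⟨e, rfl, he⟩ : Γ.ι e ⟶ Γ.ι e)) p
    have h' := congrArg (label (edgeIndicator e) (edgeIndicator_bar e)) h
    rw [label_comp, label_edge, mul_eq_left] at h'
    exact edgeIndicator_self e h'
  let C : Set Γ.V := {v | Nonempty (pt Γ x ⟶ pt Γ v)}
  let d : Γ.V → ℕ := fun v => sInf {n | Reach x n v}
  have hd : ∀ v ∈ C, Reach x (d v) v := fun v hv => Nat.sInf_mem (exists_reach hv.some)
  -- A vertex `v` farthest from `x`, which has two distinct edges `e₁`, `e₂` unless it is `x`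
  -- itself. Approaching `v` through either of them will give two different homotopy classes.
  obtain ⟨v, hvC, hmax⟩ := Set.exists_max_image C d C.toFinite ⟨x, ⟨𝟙 _⟩⟩
  have hτC : ∀ e, Γ.ι e ∈ C → Γ.τ e ∈ C := fun e he =>
    he.map (· ≫ edge Γ (Γ.arrow e))
  by_cases hvx : v = x
  · subst hvx
    obtain ⟨e, rfl⟩ := hx
    have h := hd _ (hτC e hvC)
    have h0 : d (Γ.ι e) = 0 := Nat.le_zero.1 (Nat.sInf_le Reach.nil)
    have h1 : d (Γ.τ e) = 0 := Nat.le_zero.1 (h0 ▸ hmax _ (hτC e hvC))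
    rw [h1] at h
    generalize hu : Γ.τ e = u at h
    cases h
    exact hloop e hvC hu
  · have hne : (Γ.star v).Nonempty := by
      have h := hd v hvC
      generalize d v = n at h
      cases h with
      | nil => exact (hvx rfl).elim
      | cons n e _ => exact ⟨Γ.bar e, rfl⟩
    obtain ⟨e₁, he₁, e₂, he₂, h12⟩ : ∃ e₁ ∈ Γ.star v, ∃ e₂ ∈ Γ.star v, e₁ ≠ e₂ := by
      obtain ⟨e₁, he₁⟩ := hne
      by_contra! h
      refine hval v hvx hvC (Set.ncard_eq_one.2 ⟨e₁, ?_⟩)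
      exact Set.eq_singleton_iff_unique_mem.2 ⟨he₁, fun e he => (h e₁ he₁ e he).symm⟩
    have hC₁ : Γ.ι e₁ ∈ C := by rw [he₁]; exact hvC
    have hC₂ : Γ.ι e₂ ∈ C := by rw [he₂]; exact hvC
    -- A path no longer than the distance to `v` and not ending at `v` misses `v` altogether, hence
    -- crosses neither `e₁` nor its reverse.
    have hlabel : ∀ n u, Reach x n u → n ≤ d v → u ≠ v → ∃ p : pt Γ x ⟶ pt Γ u,
        label (edgeIndicator e₁) (edgeIndicator_bar e₁) p = 1 := by
      intro n u h
      induction h with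
      | nil => exact fun _ _ => ⟨𝟙 _, label_id _ _ _⟩
      | cons n e hn ih =>
        intro hle hne
        have hv : Γ.ι e ≠ v := by
          intro h
          have h' : d v ≤ n := Nat.sInf_le (h ▸ hn)
          omega
        obtain ⟨p, hp⟩ := ih (by omega) hv
        refine ⟨p ≫ edge Γ (Γ.arrow e), ?_⟩
        rw [label_comp, hp, label_edge, one_mul]
        refine edgeIndicator_of_ne ?_ ?_
        · rintro rfl
          exact hv he₁
        · rintro rfl
          exact hne ((Γ.τ_bar e₁).trans he₁)
    obtain ⟨p₁, hp₁⟩ := hlabel _ _ (hd _ (hτC e₁ hC₁)) (hmax _ (hτC e₁ hC₁))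
      (fun h => hloop e₁ hC₁ (h.trans he₁.symm))
    obtain ⟨p₂, hp₂⟩ := hlabel _ _ (hd _ (hτC e₂ hC₂)) (hmax _ (hτC e₂ hC₂))
      (fun h => hloop e₂ hC₂ (h.trans he₂.symm))
    have h := hsub
      (p₁ ≫ edge Γ (⟨Γ.bar e₁, rfl, (Γ.τ_bar e₁).trans he₁⟩ : Γ.τ e₁ ⟶ v))
      (p₂ ≫ edge Γ (⟨Γ.bar e₂, rfl, (Γ.τ_bar e₂).trans he₂⟩ : Γ.τ e₂ ⟶ v))
    have h' := congrArg (label (edgeIndicator e₁) (edgeIndicator_bar e₁)) h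
    rw [label_comp, label_edge, label_comp, label_edge, hp₁, hp₂, one_mul, one_mul,
      edgeIndicator_bar, edgeIndicator_of_ne (e := Γ.bar e₂), inv_eq_one] at h'
    · exact edgeIndicator_self e₁ h'
    · intro h
      refine hloop e₂ hC₂ ?_
      have : Γ.τ e₂ = Γ.ι e₁ := congrArg Γ.ι h
      rw [this, he₁, he₂]
    · exact fun h => h12 (Γ.bar_injective h).symm

end Nontrivial

/-- The circle lifts to `Δ`; joining `a` to it by `q` turns its loops into loops at `a`. The
conjugating element is the image of `q` followed by `γ`. -/
theorem Hom.Identifies.conjugateInto {Δ Γ S : SerreGraph.{u}} {f : Hom Δ Γ} {a b : Δ.V} {x : Γ.V}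
    (hf : f.Identifies a b x) {w' : Hom S Δ} {w : Hom S Γ} (hw : w'.comp f = w) {s : S.V}
    (γ : pt Γ (w.onV s) ⟶ pt Γ x) {K : Subgroup (Γ.π₁ x)}
    (hK : ∀ g ∈ K, ∃ p : S.π₁ s, inv γ ≫ w.mapHom p ≫ γ = g)
    (q : pt Δ a ⟶ pt Δ (w'.onV s)) : ConjugateInto K hf.left.range := by
  subst hw
  change pt Γ (f.onV (w'.onV s)) ⟶ pt Γ x at γ
  refine ⟨f.mapTo hf.map_left rfl q ≫ γ, fun g hg => ?_⟩
  obtain ⟨p, rfl⟩ := hK g hg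
  refine ⟨q ≫ w'.mapHom p ≫ inv q, ?_⟩
  change f.mapTo hf.map_left hf.map_left _ = _
  rw [Hom.mapTo_comp f _ rfl, Hom.mapTo_comp f rfl rfl, Hom.mapTo_rfl,
    Hom.mapTo_inv f hf.map_left rfl, Hom.comp_mapHom]
  have key : ∀ {c d : Γ.FundGpd} (α : c ⟶ d) (γ : d ⟶ c) (W : d ⟶ d),
      α ≫ W ≫ inv α = (α ≫ γ) * (inv γ ≫ W ≫ γ) * (α ≫ γ)⁻¹ := by
    intro c d α γ W
    rw [Groupoid.vertexGroup.inv_eq_inv]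
    change _ = ((α ≫ γ) ≫ (inv γ ≫ W ≫ γ)) ≫ _
    simp
  exact key (f.mapTo hf.map_left rfl q) γ (f.mapHom (w'.mapHom p))

/-! ### Splitting a vertex -/

/-- Split off a new vertex `none` as the origin of the edges in `B`. -/
noncomputable def splitVertex (Γ : SerreGraph.{u}) (B : Set Γ.E) : SerreGraph.{u} where
  V := Option Γ.V
  E := Γ.E
  bar := Γ.bar
  bar_bar := Γ.bar_bar
  bar_ne := Γ.bar_ne
  ι := Γ.splitι B

variable {Γ : SerreGraph.{u}} {B : Set Γ.E} {x : Γ.V}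

/-- Glue the new vertex back to the old one. -/
noncomputable def collapse (hB : B ⊆ Γ.star x) : Hom (Γ.splitVertex B) Γ where
  onV v := v.getD x
  onE := id
  map_ι e := (splitι_getD hB e).symm
  map_bar _ := rfl

theorem identifies_collapse (hB : B ⊆ Γ.star x) :
    (collapse hB).Identifies (some x : Option Γ.V) (none : Option Γ.V) x where
  map_left := rfl
  map_right := rfl
  bijective_onE := Function.bijective_id
  eq_or {u v} h := by
    rcases u with _ | u <;> rcases v with _ | v
    · exact .inl rfl
    · exact .inr (.inr ⟨rfl, congrArg some h.symm⟩)
    · exact .inr (.inl ⟨congrArg some h, rfl⟩)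
    · exact .inl (congrArg some h)

theorem splitVertex_star (hB : B ⊆ Γ.star x) {y : Γ.V} (hy : y ≠ x) :
    (Γ.splitVertex B).star (some y : Option Γ.V) = Γ.star y := by
  ext e
  change Γ.splitι B e = some y ↔ Γ.ι e = y
  by_cases h : e ∈ B
  · rw [splitι_of_mem h]
    exact ⟨fun h => (Option.some_ne_none _ h.symm).elim,
      fun h' => (hy (h'.symm.trans (hB h))).elim⟩
  · rw [splitι_of_notMem h, Option.some_inj]

end SerreGraph

/-! ### Relative free splittings from partitions of a star -/

open SerreGraph FundGpd

namespace GraphPair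

variable {P : GraphPair.{u}} {x : P.Γ.V} {B : Set P.Γ.E}

open Classical in
/-- The lift of the circles to a graph in which a vertex is split. -/
noncomputable def splitOnV (P : GraphPair.{u}) (B : Set P.Γ.E) (s : P.S.V) : Option P.Γ.V :=
  if ∃ e, P.S.ι e = s ∧ P.w.onE e ∈ B then none else some (P.w.onV s)

theorem splitOnV_getD (hB : B ⊆ P.Γ.star x) (s : P.S.V) :
    (P.splitOnV B s).getD x = P.w.onV s := by
  unfold splitOnV
  split_ifs with h
  · obtain ⟨e, rfl, he⟩ := h
    exact (hB he).symm.trans (P.w.map_ι e)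
  · rfl

/-- The origin of a lifted edge, if the partition of the star is respected at that edge. -/
theorem splitι_onE (e : P.S.E)
    (h : ∀ e', P.S.ι e' = P.S.ι e → P.w.onE e' ∈ B → P.w.onE e ∈ B) :
    P.Γ.splitι B (P.w.onE e) = P.splitOnV B (P.S.ι e) := by
  unfold splitOnV
  split_ifs with h'
  · obtain ⟨e', he', hB'⟩ := h'
    exact splitι_of_mem (h e' he' hB')
  · rw [splitι_of_notMem fun he => h' ⟨e, rfl, he⟩, P.w.map_ι]

/-- If the star of `x` is partitioned compatibly with the circles, then the fundamental group
splits freely relative to the circles. -/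
theorem splitsFreelyRel_of_partition (hB : B ⊆ P.Γ.star x) (hne : B.Nonempty)
    {c : P.Γ.E} (hc : c ∈ P.Γ.star x) (hcB : c ∉ B)
    (hlink : ∀ e e', P.S.ι e' = P.S.ι e → P.w.onE e' ∈ B → P.w.onE e ∈ B) :
    SplitsFreelyRel (P.peripheral x) := by
  have := P.finite_ΓV
  have hf := identifies_collapse hB
  -- By `hlink` both edges at a vertex of a circle lie on the same side of the partition, so the
  -- circles lift to the split graph.
  let w' : SerreGraph.Hom P.S (P.Γ.splitVertex B) :=
    { onV := P.splitOnV B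
      onE := P.w.onE
      map_ι := fun e => splitι_onE e (hlink e)
      map_bar := P.w.map_bar }
  have hw : w'.comp (collapse hB) = P.w := SerreGraph.Hom.ext (funext (splitOnV_getD hB)) rfl
  have hfin : Finite (P.Γ.splitVertex B).V := inferInstanceAs (Finite (Option P.Γ.V))
  have hK : ∀ i, ∀ g ∈ P.peripheral x i,
      ∃ p : P.S.π₁ i.1, inv i.2 ≫ P.w.mapHom p ≫ i.2 = g := fun i g hg =>
    P.mem_peripheral.1 hg
  have hconn : ∀ i : Σ s : P.S.V, (pt P.Γ (P.w.onV s) ⟶ pt P.Γ x), _ := fun i =>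
    hf.nonempty_hom (inv i.2) (splitOnV_getD hB i.1 : (collapse hB).onV (w'.onV i.1) = _)
  by_cases hab : Nonempty (pt (P.Γ.splitVertex B) (some x : Option P.Γ.V) ⟶
      pt (P.Γ.splitVertex B) (none : Option P.Γ.V))
  · obtain ⟨t, ht, hinf⟩ :=
      hf.exists_isInternalFreeProduct_zpowers (Option.some_ne_none x) hab
    refine .inr ⟨_, t, ht, hinf, fun i => ?_⟩
    obtain ⟨q⟩ : Nonempty (pt (P.Γ.splitVertex B) (some x : Option P.Γ.V) ⟶
        pt (P.Γ.splitVertex B) (w'.onV i.1)) :=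
      (hconn i).elim id fun h => h.map (hab.some ≫ ·)
    exact hf.conjugateInto hw i.2 (hK i) q
  · have hne_bot : ∀ {H G : Type u} [Group H] [Group G] (g : H →* G),
        Function.Injective g → Nontrivial H → g.range ≠ ⊥ := by
      intro H G _ _ g hg hH h
      obtain ⟨y, hy⟩ := exists_ne (1 : H)
      have : g y ∈ g.range := ⟨y, rfl⟩
      rw [h, Subgroup.mem_bot] at this
      exact hy (hg (this.trans g.map_one.symm))
    refine .inl ⟨_, _, hf.isInternalFreeProduct hab, hne_bot _ hf.left_injective ?_,
      hne_bot _ hf.symm.left_injective ?_, fun i => ?_⟩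
    -- Splitting can create valence one only at the two halves of `x`. Each half is the base point
    -- of its own component, where `nontrivial_π₁` asks only for a non-empty star.
    · refine nontrivial_π₁ ⟨c, ?_⟩ ?_
      · exact (splitι_of_notMem hcB).trans (congrArg some hc)
      · rintro (_ | y) hy hxy
        · exact (hab hxy).elim
        · rw [splitVertex_star hB fun h => hy (congrArg some h)]
          exact P.valence_ne_one y
    · refine nontrivial_π₁ ⟨hne.some, splitι_of_mem hne.some_mem⟩ ?_
      rintro (_ | y) hy hxy
      · exact (hy rfl).elim
      · rw [splitVertex_star hB]
        · exact P.valence_ne_one y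
        · rintro rfl
          exact hab (hxy.map fun p => inv p)
    · rcases hconn i with ⟨⟨q⟩⟩ | ⟨⟨q⟩⟩
      · exact .inl (hf.conjugateInto hw i.2 (hK i) q)
      · exact .inr (hf.symm.conjugateInto hw i.2 (hK i) q)

end GraphPair

open SerreGraph FundGpd

namespace GraphPair

variable (P : GraphPair.{u})

/-! ### Components which are circles -/

theorem exists_other_edge (e : P.S.E) : ∃ e', e' ≠ e ∧ P.S.ι e' = P.S.ι e := by
  obtain ⟨p, q, hne, hpq⟩ := Set.ncard_eq_two.1 (P.valence_eq_two (P.S.ι e))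
  have hp : P.S.ι p = P.S.ι e := (hpq ▸ Set.mem_insert p {q} : p ∈ P.S.star (P.S.ι e))
  have hq : P.S.ι q = P.S.ι e :=
    (hpq ▸ Set.mem_insert_of_mem p rfl : q ∈ P.S.star (P.S.ι e))
  by_cases h : p = e
  · exact ⟨q, fun h' => hne (h.trans h'.symm), hq⟩
  · exact ⟨p, h, hp⟩

theorem eq_or_eq_of_ι_eq {e e' e'' : P.S.E} (h : e' ≠ e) (h' : P.S.ι e' = P.S.ι e)
    (h'' : P.S.ι e'' = P.S.ι e) : e'' = e ∨ e'' = e' := by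
  by_contra! hne
  have hsub : ({e, e', e''} : Set P.S.E) ⊆ P.S.star (P.S.ι e) := by
    rintro _ (rfl | rfl | rfl)
    exacts [rfl, h', h'']
  have := P.finite_SE
  have hcard := Set.ncard_le_ncard hsub (Set.toFinite _)
  rw [P.valence_eq_two, Set.ncard_eq_three.2 ⟨e, e', e'', h.symm, hne.1.symm, hne.2.symm, rfl⟩]
    at hcard
  omega

theorem eq_of_onE_eq {e e' : P.S.E} (h : P.S.ι e = P.S.ι e') (hw : P.w.onE e = P.w.onE e') :
    e = e' := P.immersion (P.S.ι e') h rfl hw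

theorem exists_ι_eq (s : P.S.V) : ∃ e, P.S.ι e = s := by
  have h : (P.S.star s).ncard ≠ 0 := by rw [P.valence_eq_two]; decide
  exact Set.nonempty_of_ncard_ne_zero h

/-- Exactly one circle passes through `v`, exactly once, and it runs along every edge at `v`. -/
def IsCircleAt (v : P.Γ.V) : Prop :=
  (∀ a ∈ P.Γ.star v, ∃! e, P.w.onE e = a) ∧ ∀ s t, P.w.onV s = v → P.w.onV t = v → s = t

variable {P}

/-- Since `w` is injective on stars, Whitehead graphs have no loops and each incidence at `a` comes
from exactly one edge over `a`; valence one leaves a single such edge. -/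
theorem existsUnique_onE_of_isLeaf {v : P.Γ.V} {a : P.Γ.E} (h : (P.whitehead v).IsLeaf a) :
    a ∈ P.Γ.star v ∧ ∃! e, P.w.onE e = a := by
  obtain ⟨ha, hval⟩ := h
  change a ∈ P.Γ.star v at ha
  have hloop : (P.whitehead v).loopSet a = ∅ := by
    refine Set.eq_empty_of_forall_notMem ?_
    rintro s ⟨-, e₁, e₂, hne, h₁, h₂, ha₁, ha₂⟩
    exact hne (P.eq_of_onE_eq (h₁.trans h₂.symm) (ha₁.trans ha₂.symm))
  unfold Graph.valence at hval
  rw [hloop, Set.ncard_empty, add_zero] at hval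
  obtain ⟨s, hs⟩ := Set.ncard_eq_one.1 hval
  have hinc : ∀ e, P.w.onE e = a → P.S.ι e = s := by
    intro e he
    have : P.S.ι e ∈ (P.whitehead v).incidenceSet a := by
      obtain ⟨e', hne, he'⟩ := P.exists_other_edge e
      refine ⟨P.w.onE e', ?_, e, e', hne.symm, rfl, he', he, rfl⟩
      rw [← P.w.map_ι, he]
      exact ha
    rwa [hs] at this
  have hmem : s ∈ (P.whitehead v).incidenceSet a := by rw [hs]; rfl
  obtain ⟨b, -, e, -, -, he, -, hea, -⟩ := hmem
  exact ⟨ha, e, hea, fun e' he' =>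
    P.eq_of_onE_eq ((hinc e' he').trans he.symm) (he'.trans hea.symm)⟩

/-- The edge `a` has a single neighbour `b` in the Whitehead graph. A third element of the star
would be separated from `a` by removing `b`, so without cut vertices the star is `{a, b}`, with one
turn between them. -/
theorem isCircleAt_of_existsUnique {v : P.Γ.V} {a : P.Γ.E} (ha : a ∈ P.Γ.star v)
    (hu : ∃! e, P.w.onE e = a) (hcut : ∀ e, ¬ (P.whitehead v).IsCutVertex e) :
    P.IsCircleAt v := by
  obtain ⟨e, rfl, hu⟩ := hu
  obtain ⟨e', hne, he'⟩ := P.exists_other_edge e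
  have hv : P.Γ.ι (P.w.onE e) = v := ha
  have hb : P.w.onE e' ∈ P.Γ.star v := by
    change P.Γ.ι _ = v
    rw [P.w.map_ι, he', ← P.w.map_ι, hv]
  have hab : P.w.onE e' ≠ P.w.onE e := fun h => hne (P.eq_of_onE_eq he' h)
  have hstar : ∀ c ∈ P.Γ.star v, c = P.w.onE e ∨ c = P.w.onE e' := by
    intro c hc
    by_contra! hc'
    refine hcut (P.w.onE e') ⟨hb, fun hconn => ?_⟩
    have h := hconn (P.w.onE e) ⟨ha, hab.symm⟩ c ⟨hc, hc'.2⟩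
    rcases h.cases_head with h | ⟨d, ⟨s, hs⟩, -⟩
    · exact hc'.1 h.symm
    · rw [Graph.deleteVerts_isLink] at hs
      obtain ⟨⟨-, e₁, e₂, h12, h₁, h₂, ha₁, ha₂⟩, -, hd⟩ := hs
      obtain rfl := hu e₁ ha₁
      rcases P.eq_or_eq_of_ι_eq hne he' (h₂.trans h₁.symm) with rfl | rfl
      · exact h12 rfl
      · exact hd ha₂.symm
  have hu' : ∀ e₃, P.w.onE e₃ = P.w.onE e' → e₃ = e' := by
    intro e₃ h₃
    obtain ⟨e₄, h34, h₄⟩ := P.exists_other_edge e₃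
    have hmem : P.w.onE e₄ ∈ P.Γ.star v := by
      change P.Γ.ι _ = v
      rw [P.w.map_ι, h₄, ← P.w.map_ι, h₃]
      exact hb
    rcases hstar _ hmem with h | h
    · obtain rfl := hu e₄ h
      rcases P.eq_or_eq_of_ι_eq hne he' h₄.symm with rfl | rfl
      · exact (h34 rfl).elim
      · rfl
    · exact (h34 (P.eq_of_onE_eq h₄ (h.trans h₃.symm))).elim
  refine ⟨fun c hc => ?_, ?_⟩
  · rcases hstar c hc with rfl | rfl
    · exact ⟨e, rfl, hu⟩
    · exact ⟨e', rfl, hu'⟩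
  · have hs : ∀ s, P.w.onV s = v → s = P.S.ι e := by
      intro s hs
      obtain ⟨e₃, rfl⟩ := P.exists_ι_eq s
      rcases hstar (P.w.onE e₃) ((P.w.map_ι e₃).trans hs) with h | h
      · rw [hu e₃ h]
      · rw [hu' e₃ h, he']
    intro s t h h'
    rw [hs s h, hs t h']

theorem existsUnique_onE_bar {a : P.Γ.E} (h : ∃! e, P.w.onE e = a) :
    ∃! e, P.w.onE e = P.Γ.bar a := by
  obtain ⟨e, rfl, hu⟩ := h
  refine ⟨P.S.bar e, P.w.map_bar e, fun e' he' => ?_⟩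
  have h : P.w.onE (P.S.bar e') = P.w.onE e := by
    rw [P.w.map_bar, show P.w.onE e' = _ from he', P.Γ.bar_bar]
  rw [← hu (P.S.bar e') h, P.S.bar_bar]

/-- An edge covered exactly once has a reverse covered exactly once, so the property passes from
each vertex to its neighbours. -/
theorem isCircleAt_of_hom (hcut : ∀ v e, ¬ (P.whitehead v).IsCutVertex e) {x y : P.Γ.V}
    (hx : P.IsCircleAt x) (γ : pt P.Γ x ⟶ pt P.Γ y) : P.IsCircleAt y := by
  refine hom_induction (motive := fun y _ => P.IsCircleAt y) hx ?_ γ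
  rintro _ _ _ ⟨e, rfl, rfl⟩ h
  exact isCircleAt_of_existsUnique (a := P.Γ.bar e) rfl
    (existsUnique_onE_bar (h.1 e rfl)) (hcut _)

/-- Paths lift to the circles in a component which is a circle. -/
theorem exists_lift_path {s : P.S.V} {x y : P.Γ.V} (hs : P.w.onV s = x)
    (hx : ∀ z, Nonempty (pt P.Γ x ⟶ pt P.Γ z) → P.IsCircleAt z) (γ : pt P.Γ x ⟶ pt P.Γ y) :
    ∃ (t : P.S.V) (ht : P.w.onV t = y) (p : pt P.S s ⟶ pt P.S t), γ = P.w.mapTo hs ht p := by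
  refine hom_induction (motive := fun y γ => ∃ (t : P.S.V) (ht : P.w.onV t = y)
    (p : pt P.S s ⟶ pt P.S t), γ = P.w.mapTo hs ht p) ?_ ?_ γ
  · exact ⟨s, hs, 𝟙 _, (P.w.mapTo_id hs).symm⟩
  · rintro y z g ⟨a, ha⟩ ⟨t, ht, p, rfl⟩
    have hy := hx y ⟨P.w.mapTo hs ht p⟩
    obtain ⟨e, rfl, -⟩ := hy.1 a ha.1
    obtain rfl : P.S.ι e = t := hy.2 _ _ ((P.w.map_ι e).symm.trans ha.1) ht
    have hz : P.w.onV (P.S.τ e) = z := (P.w.map_τ e).symm.trans ha.2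
    refine ⟨P.S.τ e, hz, p ≫ edge P.S (P.S.arrow e), ?_⟩
    rw [SerreGraph.Hom.mapTo_comp P.w hs ht hz, P.w.mapTo_edge ht hz]
    rfl

/-- The circle condition spreads over the whole component. Every path then lifts to a circle, and
since fibres of vertices are single points, closed paths lift to closed paths and there is no second
circle. -/
theorem isCyclicAt_of_isLeaf (hcut : ∀ v e, ¬ (P.whitehead v).IsCutVertex e) {x : P.Γ.V}
    {a : P.Γ.E} (ha : (P.whitehead x).IsLeaf a) : P.IsCyclicAt x := by
  obtain ⟨hax, hu⟩ := existsUnique_onE_of_isLeaf ha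
  have hx : P.IsCircleAt x := isCircleAt_of_existsUnique hax hu (hcut x)
  constructor
  · obtain ⟨e, he, -⟩ := hu
    have hs : P.w.onV (P.S.ι e) = x := by rw [← P.w.map_ι, he]; exact hax
    refine ⟨⟨P.S.ι e, eqToHom (congrArg (pt P.Γ) hs)⟩, ?_⟩
    rw [eq_top_iff]
    intro γ _
    obtain ⟨t, ht, p, rfl⟩ := exists_lift_path hs
      (fun z ⟨γ⟩ => isCircleAt_of_hom hcut hx γ) γ
    obtain rfl := hx.2 _ _ hs ht
    refine P.mem_peripheral.2 ⟨p, ?_⟩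
    rw [inv_eqToHom]
    rfl
  · rintro s t ⟨γ⟩ ⟨δ⟩
    have hall : ∀ z, Nonempty (pt P.Γ (P.w.onV s) ⟶ pt P.Γ z) → P.IsCircleAt z :=
      fun z ⟨ε⟩ => isCircleAt_of_hom hcut hx (inv γ ≫ ε)
    obtain ⟨t', ht', p, -⟩ := exists_lift_path rfl hall (γ ≫ inv δ)
    obtain rfl := (hall _ ⟨γ ≫ inv δ⟩).2 _ _ ht' rfl
    exact ⟨p⟩

end GraphPair

open SerreGraph FundGpd

namespace GraphPair

/-! ### Unfolding a graph pair -/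

/-- Composition of maps of pairs. -/
def Hom.comp {P Q R : GraphPair.{u}} (m : Hom P Q) (n : Hom Q R) : Hom P R where
  f := m.f.comp n.f
  φ := m.φ.comp n.φ
  immersion x e he e' he' h := by
    refine m.immersion x he he' (n.immersion (m.φ.onV x) ?_ ?_ h)
    · exact (m.φ.map_ι e).trans (congrArg _ he)
    · exact (m.φ.map_ι e').trans (congrArg _ he')
  comm_V s := (congrArg n.f.onV (m.comm_V s)).trans (n.comm_V _)
  comm_E e := (congrArg n.f.onE (m.comm_E e)).trans (n.comm_E _)

theorem Hom.IsHomotopyEquiv.comp {P Q R : GraphPair.{u}} {m : Hom P Q} {n : Hom Q R}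
    (hm : m.IsHomotopyEquiv) (hn : n.IsHomotopyEquiv) : (m.comp n).IsHomotopyEquiv :=
  ⟨hm.1.comp hn.1, hn.2.1.comp hm.2.1, hn.2.2.comp hm.2.2⟩

/-- The identity map of pairs. -/
def Hom.id (P : GraphPair.{u}) : Hom P P where
  f := .id _
  φ := .id _
  immersion _ _ _ _ _ h := h
  comm_V _ := rfl
  comm_E _ := rfl

theorem Hom.isHomotopyEquiv_id (P : GraphPair.{u}) : (Hom.id P).IsHomotopyEquiv :=
  ⟨SerreGraph.Hom.isHomotopyEquiv_id _, Function.bijective_id, Function.bijective_id⟩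

section Unfold

variable (P : GraphPair.{u}) (B : Set P.Γ.E) (a : P.Γ.E)

open Classical in
/-- The lift of the edges of the circles to the unfolded graph. -/
noncomputable def unfoldOnE (e : P.S.E) : P.Γ.E ⊕ Bool :=
  -- A passage over `a` is rerouted along the new copy exactly when its origin has moved to the new
  -- vertex, that is, when the circle turns there between `a` and `B`; the second case is the
  -- reversed passage.
  if P.w.onE e = a ∧ P.splitOnV B (P.S.ι e) = none then .inr true
  else if P.w.onE e = P.Γ.bar a ∧ P.splitOnV B (P.S.τ e) = none then .inr false
  else .inl (P.w.onE e)

variable {P B a}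

/-- Turns between `B` and `a` are allowed here, unlike in a plain vertex splitting: the rerouting of
`a` repairs them. -/
theorem unfoldOnE_ι (ha : a ∉ B)
    (hlink : ∀ e e', P.S.ι e' = P.S.ι e → P.w.onE e' ∈ B → P.w.onE e ≠ a → P.w.onE e ∈ B)
    (e : P.S.E) : (P.Γ.unfold B a).ι (P.unfoldOnE B a e) = P.splitOnV B (P.S.ι e) := by
  have hι : P.w.onE e ≠ a → P.Γ.splitι B (P.w.onE e) = P.splitOnV B (P.S.ι e) :=
    fun h => splitι_onE e fun e' he' hB' => hlink e e' he' hB' h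
  unfold unfoldOnE
  split_ifs with h₁ h₂
  · exact h₁.2.symm
  · rw [← hι (by rw [h₂.1]; exact P.Γ.bar_ne a), h₂.1]
    rfl
  · by_cases h : P.w.onE e = a
    · have h' : ¬ P.splitOnV B (P.S.ι e) = none := fun h' => h₁ ⟨h, h'⟩
      change P.Γ.splitι B (P.w.onE e) = _
      rw [h, splitι_of_notMem ha]
      unfold splitOnV at h' ⊢
      split_ifs with h''
      · exact (h' (if_pos h'')).elim
      · rw [← P.w.map_ι, h]
    · exact hι h

theorem unfoldOnE_bar (e : P.S.E) :
    P.unfoldOnE B a (P.S.bar e) = (P.Γ.unfold B a).bar (P.unfoldOnE B a e) := by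
  have h₁ : P.Γ.bar (P.w.onE e) = a ↔ P.w.onE e = P.Γ.bar a :=
    ⟨fun h => by rw [← h, P.Γ.bar_bar], fun h => by rw [h, P.Γ.bar_bar]⟩
  have h₂ : P.Γ.bar (P.w.onE e) = P.Γ.bar a ↔ P.w.onE e = a := P.Γ.bar_injective.eq_iff
  have h₃ : P.S.ι (P.S.bar e) = P.S.τ e := rfl
  unfold unfoldOnE
  rw [P.w.map_bar, h₁, h₂, h₃, P.S.τ_bar]
  have hexcl : P.w.onE e = a → P.w.onE e = P.Γ.bar a → False := fun h h' =>
    P.Γ.bar_ne a (h'.symm.trans h)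
  split_ifs with h h' h'
  · exact (hexcl h'.1 h.1).elim
  · rfl
  · rfl
  · rfl

theorem fold_unfoldOnE (hB : B ⊆ P.Γ.star (P.Γ.ι a)) (e : P.S.E) :
    (fold hB).onE (P.unfoldOnE B a e) = P.w.onE e := by
  unfold unfoldOnE
  split_ifs with h₁ h₂
  · exact h₁.1.symm
  · exact h₂.1.symm
  · rfl

/-- The new vertex carries an element of `B` and the new copy of `a`; the old one keeps `a` and `c`.
Any other vertex keeps its star, up to an extra end of the new edge next to `bar a`. -/
theorem unfold_valence (hB : B ⊆ P.Γ.star (P.Γ.ι a)) (ha : a ∉ B) (hne : B.Nonempty)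
    {c : P.Γ.E} (hc : c ∈ P.Γ.star (P.Γ.ι a)) (hcB : c ∉ B) (hca : c ≠ a)
    (v : (P.Γ.unfold B a).V) : ((P.Γ.unfold B a).star v).ncard ≠ 1 := by
  intro h
  obtain ⟨z, hz⟩ := Set.ncard_eq_one.1 h
  have hz' : ∀ e, (P.Γ.unfold B a).ι e = v → e = z := fun e he => by
    have : e ∈ (P.Γ.unfold B a).star v := he
    rwa [hz] at this
  rcases v with _ | v
  · obtain ⟨b, hb⟩ := hne
    have h₁ := hz' (.inl b) (splitι_of_mem hb)
    have h₂ := hz' (.inr true) rfl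
    exact Sum.inl_ne_inr (h₁.trans h₂.symm)
  · by_cases hv : v = P.Γ.ι a
    · subst hv
      have h₁ := hz' (.inl a) (splitι_of_notMem ha)
      have h₂ := hz' (.inl c) ((splitι_of_notMem hcB).trans (congrArg some hc))
      exact hca (Sum.inl_injective (h₂.trans h₁.symm))
    · have hmem : ∀ e, P.Γ.ι e = v ↔ (P.Γ.unfold B a).ι (.inl e) = some v := by
        intro e
        change _ ↔ P.Γ.splitι B e = some v
        by_cases he : e ∈ B
        · rw [splitι_of_mem he]
          exact ⟨fun h => (hv (h.symm.trans (hB he))).elim,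
            fun h => (Option.some_ne_none _ h.symm).elim⟩
        · rw [splitι_of_notMem he, Option.some_inj]
      have hzmem : (P.Γ.unfold B a).ι z = some v := by
        have : z ∈ (P.Γ.unfold B a).star (some v : Option P.Γ.V) := by rw [hz]; rfl
        exact this
      obtain ⟨e, rfl⟩ : ∃ e, z = .inl e := by
        rcases z with e | _ | _
        · exact ⟨e, rfl⟩
        · exact ⟨_, (hz' (.inl (P.Γ.bar a)) hzmem).symm⟩
        · exact (Option.some_ne_none _ hzmem.symm).elim
      refine P.valence_ne_one v (Set.ncard_eq_one.2 ⟨e, ?_⟩)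
      refine Set.eq_singleton_iff_unique_mem.2 ⟨(hmem e).2 hzmem, fun e' he' => ?_⟩
      exact Sum.inl_injective (hz' _ ((hmem e').1 he'))

/-- A partition of the star of a vertex, away from an edge `a`, which is compatible with the
circles yields a homotopy equivalent pair with more edges. -/
theorem exists_unfold (hB : B ⊆ P.Γ.star (P.Γ.ι a)) (ha : a ∉ B) (hne : B.Nonempty)
    {c : P.Γ.E} (hc : c ∈ P.Γ.star (P.Γ.ι a)) (hcB : c ∉ B) (hca : c ≠ a)
    (hlink : ∀ e e', P.S.ι e' = P.S.ι e → P.w.onE e' ∈ B → P.w.onE e ≠ a → P.w.onE e ∈ B) :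
    ∃ (P' : GraphPair.{u}) (m : Hom P' P), m.IsHomotopyEquiv ∧
      Nat.card P'.S.E = Nat.card P.S.E ∧ Nat.card P.Γ.E < Nat.card P'.Γ.E := by
  have h₁ := P.finite_ΓV
  have h₂ := P.finite_ΓE
  let P' : GraphPair.{u} :=
    { Γ := P.Γ.unfold B a
      S := P.S
      finite_ΓV := inferInstanceAs (Finite (Option P.Γ.V))
      finite_ΓE := inferInstanceAs (Finite (P.Γ.E ⊕ Bool))
      finite_SV := P.finite_SV
      finite_SE := P.finite_SE
      valence_ne_one := unfold_valence hB ha hne hc hcB hca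
      valence_eq_two := P.valence_eq_two
      w :=
        { onV := P.splitOnV B
          onE := P.unfoldOnE B a
          map_ι := unfoldOnE_ι ha hlink
          map_bar := unfoldOnE_bar }
      immersion := fun s e he e' he' h => P.immersion s he he' (by
        rw [← fold_unfoldOnE hB e, ← fold_unfoldOnE hB e']
        exact congrArg _ h) }
  let m : Hom P' P :=
    { f := fold hB
      φ := SerreGraph.Hom.id _
      immersion := fun _ _ _ _ _ h => h
      comm_V := splitOnV_getD hB
      comm_E := fold_unfoldOnE hB }
  refine ⟨P', m, ⟨isHomotopyEquiv_fold hB ha, Function.bijective_id, Function.bijective_id⟩,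
    rfl, ?_⟩
  change _ < Nat.card (P.Γ.E ⊕ Bool)
  rw [Nat.card_sum, Nat.card_eq_fintype_card (α := Bool), Fintype.card_bool]
  omega

end Unfold

/-! ### Whitehead graphs of irreducible pairs -/

variable {P : GraphPair.{u}}

theorem whitehead_isLink {v : P.Γ.V} {e e' : P.S.E} (hne : e ≠ e') (h : P.S.ι e = P.S.ι e')
    (hv : P.w.onE e ∈ P.Γ.star v) :
    (P.whitehead v).IsLink (P.S.ι e) (P.w.onE e) (P.w.onE e') :=
  ⟨(P.w.map_ι e).symm.trans hv, e, e', hne, rfl, h.symm, rfl, rfl⟩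

theorem onE_mem_star {v : P.Γ.V} {e e' : P.S.E} (h : P.S.ι e' = P.S.ι e)
    (hv : P.w.onE e ∈ P.Γ.star v) : P.w.onE e' ∈ P.Γ.star v := by
  change P.Γ.ι _ = v
  rw [P.w.map_ι, h, ← P.w.map_ι]
  exact hv

/-- A connected component of the Whitehead graph is one side of a partition respected by all turns.
-/
theorem isPathConnected_whitehead (hP : P.IsIrreducible) (x : P.Γ.V) :
    (P.whitehead x).IsPathConnected := by
  intro b hb c hc
  by_contra hbc
  refine (hP x).2.1 (splitsFreelyRel_of_partition (c := c)
    (B := {d | d ∈ P.Γ.star x ∧ Relation.ReflTransGen (P.whitehead x).Adj b d})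
    (fun d hd => hd.1) ⟨b, hb, .refl⟩ hc (fun h => hbc h.2) ?_)
  intro e e' h he'
  by_cases hne : e' = e
  · exact hne ▸ he'
  · exact ⟨onE_mem_star h.symm he'.1, he'.2.tail ⟨_, whitehead_isLink hne h he'.1⟩⟩

/-- Here `B` is a component of the Whitehead graph with `a` removed, and `c` lies in another one. -/
theorem exists_unfold_of_isCutVertex {x : P.Γ.V} {a : P.Γ.E}
    (ha : (P.whitehead x).IsCutVertex a) :
    ∃ (P' : GraphPair.{u}) (m : Hom P' P), m.IsHomotopyEquiv ∧
      Nat.card P'.S.E = Nat.card P.S.E ∧ Nat.card P.Γ.E < Nat.card P'.Γ.E := by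
  obtain ⟨hax, hdis⟩ := ha
  obtain rfl : P.Γ.ι a = x := hax
  unfold Graph.IsPathConnected at hdis
  push Not at hdis
  obtain ⟨b, hb, c, hc, hbc⟩ := hdis
  rw [Graph.vertexSet_deleteVerts] at hb hc
  refine exists_unfold (a := a) (c := c)
    (B := {d | (d ∈ P.Γ.star (P.Γ.ι a) ∧ d ≠ a) ∧
      Relation.ReflTransGen ((P.whitehead (P.Γ.ι a)).deleteVerts {a}).Adj b d})
    (fun d hd => hd.1.1) (fun h => h.1.2 rfl) ⟨b, hb, .refl⟩ hc.1 (fun h => hbc h.2) hc.2 ?_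
  intro e e' h he' hea
  by_cases hne : e' = e
  · exact hne ▸ he'
  · refine ⟨⟨onE_mem_star h.symm he'.1.1, hea⟩, he'.2.tail ⟨P.S.ι e', ?_⟩⟩
    rw [Graph.deleteVerts_isLink]
    exact ⟨whitehead_isLink hne h he'.1.1, he'.1.2, hea⟩

theorem star_nonempty (hP : P.IsIrreducible) (x : P.Γ.V) : (P.Γ.star x).Nonempty := by
  by_contra! h
  have hid : ∀ {y : P.Γ.V} (p : pt P.Γ x ⟶ pt P.Γ y), ∃ h : x = y, p = eqToHom (h ▸ rfl) := by
    intro y p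
    refine hom_induction (motive := fun y p => ∃ h : x = y, p = eqToHom (h ▸ rfl)) ⟨rfl, rfl⟩
      ?_ p
    rintro y z g ⟨e, he⟩ ⟨rfl, -⟩
    have : e ∈ P.Γ.star x := he.1
    rw [h] at this
    exact this.elim
  obtain ⟨g, hg⟩ := (nontrivial_iff_exists_ne (1 : P.Γ.π₁ x)).1 (hP x).1
  obtain ⟨_, h⟩ := hid g
  exact hg h

/-- The star containing `a` has a second element, since its valence is not one. A path to it in the
connected Whitehead graph leaves `a` by a turn of `w`. The resulting bound on the number of edges of
`Γ` makes the unfolding process stop. -/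
theorem onE_surjective (hP : P.IsIrreducible) : Function.Surjective P.w.onE := by
  intro a
  obtain ⟨c, hc, hca⟩ : ∃ c ∈ P.Γ.star (P.Γ.ι a), c ≠ a := by
    by_contra! h
    exact P.valence_ne_one (P.Γ.ι a) (Set.ncard_eq_one.2
      ⟨a, Set.eq_singleton_iff_unique_mem.2 ⟨rfl, h⟩⟩)
  rcases (isPathConnected_whitehead hP (P.Γ.ι a) a rfl c hc).cases_head with
    h | ⟨d, ⟨s, -, e, -, -, -, -, he, -⟩, -⟩
  · exact (hca h.symm).elim
  · exact ⟨e, he⟩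

theorem exists_isLocallyIrreducible (n : ℕ) (P : GraphPair.{u}) (hP : P.IsIrreducible)
    (hn : Nat.card P.S.E - Nat.card P.Γ.E = n) :
    ∃ (P' : GraphPair.{u}) (m : Hom P' P), P'.IsLocallyIrreducible ∧ m.IsHomotopyEquiv := by
  induction n using Nat.strong_induction_on generalizing P with
  | _ n ih =>
    by_cases hcut : ∃ v e, (P.whitehead v).IsCutVertex e
    · obtain ⟨v, e, he⟩ := hcut
      obtain ⟨Q, m, hm, hS, hΓ⟩ := exists_unfold_of_isCutVertex he
      have hQ := hm.isIrreducible hP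
      have := Q.finite_SE
      -- The bound is applied to the unfolded pair `Q`: with the strict increase in edges it makes
      -- the truncated difference for `P` positive, so that it really decreases.
      have hle := Nat.card_le_card_of_surjective _ (onE_surjective hQ)
      obtain ⟨P', m', hloc, hm'⟩ := ih _ (by omega) Q hQ rfl
      exact ⟨P', m'.comp m, hloc, hm'.comp hm⟩
    · push Not at hcut
      exact ⟨P, .id P, fun x => ⟨star_nonempty hP x, isPathConnected_whitehead hP x,
        fun a ha => (hP x).2.2 (isCyclicAt_of_isLeaf hcut ha), hcut x⟩,
        Hom.isHomotopyEquiv_id P⟩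

end GraphPair

theorem mainTheorem5 (P : GraphPair.{u}) (hP : P.IsIrreducible) :
    ∃ (P' : GraphPair.{u}) (m : GraphPair.Hom P' P),
      P'.IsLocallyIrreducible ∧ m.IsHomotopyEquiv :=
  GraphPair.exists_isLocallyIrreducible _ P hP rfl
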